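/- **Theorem 9.3.** Let $\mathcal K=L^2(\mathbb R_+)$, let $\mathcal G$ be a complex Hilbert space with a countably infinite orthonormal basis $(e_k)_{k\ge 1}$, and let $\mathcal H=L^2(\mathbb R_+,\mathcal G)\cong\mathcal K\otimes\mathcal G$. All scalar products are linear in the second argument. Let $\Gamma(\mathcal H)=\mathbb C\Omega\oplus\bigoplus_{n\ge 1}\mathcal H^{\circ n}$ be the symmetric Fock space, where $\mathcal H^{\circ n}\subseteq\mathcal H^{\otimes n}$ is the closed span of the vectors $v_1\circ\dots\circ v_n=\frac1{n!}\sum_{\sigma\in S_n}v_{\sigma(1)}\otimes\dots\otimes v_{\sigma(n)}$. Let $a^*(u)$, $a(u)$ $(u\in\mathcal H)$ be the boson creation and annihilation operators, $$a^*(u)\,v_1\circ\dots\circ v_n=\sqrt{n+1}\;u\circ v_1\circ\dots\circ v_n,\qquad a(u)\,v_1\circ\dots\circ v_n=\tfrac1{\sqrt n}\sum_{j=1}^n\langle u,v_j\rangle\, v_1\circ\dots\breve v_j\dots\circ v_n ,\qquad a(u)\Omega=0.$$ For an integer $r\ge 1$ let $P^{(r)}$ be the second quantization of the orthogonal projection of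 $\mathcal H$ onto $\mathcal H^{(r)}=\{\sum_{k=1}^{r-1}u^{(k)}\otimes e_k : u^{(k)}\in\mathcal K\}$ (so $P^{(1)}$ is the projection onto $\mathbb C\Omega$); put $P^{(0)}=0$ and $P^{(\infty)}=I$. For $f\in\mathcal K$ put $a^{(r)*}(f\otimes e_k)=a^*(f\otimes e_k)P^{(r)}$, $a^{(r)}(f\otimes e_k)=P^{(r)}a(f\otimes e_k)$ and, for $m\in\{1,2,\dots\}\cup\{\infty\}$, $$l^{(m)*}(f)=\sum_{k=1}^m\bigl(a^{(k)*}(f\otimes e_k)-a^{(k-1)*}(f\otimes e_k)\bigr),\qquad l^{(m)}(f)=\sum_{k=1}^m\bigl(a^{(k)}(f\otimes e_k)-a^{(k-1)}(f\otimes e_k)\bigr),$$ the series for $m=\infty$ being understood as strongly convergent. Then, for every $m\in\{1,2,\dots\}\cup\{\infty\}$ and all $f,g\in\mathcal K$: the operators $l^{(m)*}(f)$ and $l^{(m)}(f)$ are defined on the finite particle domain, i.e. the linear span of $\Omega$ and the vectors $v_1\circ\dots\circ v_n$ with $v_j\in\mathcal H$; each has a unique bounded extension to $\Gamma(\mathcal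 H)$, which is already determined by its values on the linear span of $\Omega$ and the vectors $(f_1\otimes e_{k_1})\circ\dots\circ(f_n\otimes e_{k_n})$. These extensions, denoted by the same symbols, have norm $$\|l^{(m)*}(f)\|=\|l^{(m)}(f)\|=\|f\| ,$$ are adjoints of each other, and satisfy $$l^{(m)}(g)\,l^{(m)*}(f)=\langle g,f\rangle\,P^{(m)} .$$ -/

import Mathlib

open MeasureTheory
open scoped InnerProductSpace ENNReal

noncomputable section

namespace FilteredFock

/-! ### Hilbert space tensor powers -/

section TensorPower

open scoped ComplexOrder

variable (H : Type*) [NormedAddCommGroup H] [InnerProductSpace ℂ H]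

/-- The algebraic tensor power `H ⊗ ⋯ ⊗ H` (`n` factors). It is a separate type since it carries
the Hilbert space inner product and not the projective norm. -/
def AlgTensor (n : ℕ) : Type _ := PiTensorProduct ℂ (fun _ : Fin n => H)

instance (n : ℕ) : AddCommGroup (AlgTensor H n) :=
  inferInstanceAs (AddCommGroup (PiTensorProduct ℂ (fun _ : Fin n => H)))

instance (n : ℕ) : Module ℂ (AlgTensor H n) :=
  inferInstanceAs (Module ℂ (PiTensorProduct ℂ (fun _ : Fin n => H)))

variable {H}

/-- The elementary tensor `v 0 ⊗ ⋯ ⊗ v (n - 1)`. -/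
def algTprod (n : ℕ) : MultilinearMap ℂ (fun _ : Fin n => H) (AlgTensor H n) :=
  PiTensorProduct.tprod ℂ

/-- Linear maps out of the algebraic tensor power. -/
def algLift {n : ℕ} {E : Type*} [AddCommGroup E] [Module ℂ E]
    (φ : MultilinearMap ℂ (fun _ : Fin n => H) E) : AlgTensor H n →ₗ[ℂ] E :=
  PiTensorProduct.lift φ

theorem algLift_tprod {n : ℕ} {E : Type*} [AddCommGroup E] [Module ℂ E]
    (φ : MultilinearMap ℂ (fun _ : Fin n => H) E) (v : Fin n → H) :
    algLift φ (algTprod n v) = φ v :=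
  PiTensorProduct.lift.tprod v

theorem algTensor_exists_sum {n : ℕ} (x : AlgTensor H n) :
    ∃ (N : ℕ) (c : Fin N → ℂ) (v : Fin N → Fin n → H), x = ∑ i, c i • algTprod n (v i) := by
  have hx : x ∈ Submodule.span ℂ (Set.range (algTprod n : (Fin n → H) → AlgTensor H n)) := by
    have h : Submodule.span ℂ (Set.range (algTprod n : (Fin n → H) → AlgTensor H n)) = ⊤ :=
      PiTensorProduct.span_tprod_eq_top
    rw [h]
    trivial
  obtain ⟨N, c, g, hg⟩ := (Submodule.mem_span_set' (R := ℂ)).1 hx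
  choose v hv using fun i => (g i).2
  exact ⟨N, c, v, by rw [← hg]; simp [hv]⟩

@[elab_as_elim]
theorem algTensor_induction {n : ℕ} {p : AlgTensor H n → Prop} (x : AlgTensor H n)
    (tprod : ∀ v, p (algTprod n v)) (smul : ∀ (c : ℂ) x, p x → p (c • x))
    (add : ∀ x y, p x → p y → p (x + y)) : p x := by
  refine PiTensorProduct.induction_on (motive := p) x (fun c v => smul c _ (tprod v)) add

/-- `y ↦ ∏ j, ⟪u j, y j⟫`, extended linearly. -/
def algInnerAux {n : ℕ} (u : Fin n → H) : AlgTensor H n →ₗ[ℂ] ℂ :=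
  algLift ((MultilinearMap.mkPiAlgebra ℂ (Fin n) ℂ).compLinearMap
    fun j => (innerSL ℂ (u j)).toLinearMap)

theorem algInnerAux_tprod {n : ℕ} (u v : Fin n → H) :
    algInnerAux u (algTprod n v) = ∏ j, ⟪u j, v j⟫_ℂ := by
  simp [algInnerAux, algLift_tprod]

/-- `x ↦ ⟪y, x⟫`, the linear extension of `u ↦ conj ⟪u 0 ⊗ ⋯ ⊗ u (n - 1), y⟫`. -/
def algInnerLeft {n : ℕ} (y : AlgTensor H n) : AlgTensor H n →ₗ[ℂ] ℂ :=
  algLift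
    { toFun := fun u => star (algInnerAux u y)
      map_update_add' := by
        intro _ u i a b
        induction y using algTensor_induction with
        | tprod v =>
          have h := ((MultilinearMap.mkPiAlgebra ℂ (Fin n) ℂ).compLinearMap
            (fun j => (innerSL ℂ (v j)).toLinearMap)).map_update_add' u i a b
          simpa [algInnerAux_tprod, -MultilinearMap.map_update_add] using h
        | smul c x hx => simp only [map_smul, smul_eq_mul, star_mul', hx, mul_add]
        | add x y hx hy => simp only [map_add, star_add, hx, hy]; ring
      map_update_smul' := by
        intro _ u i c a
        induction y using algTensor_induction with
        | tprod v =>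
          have h := ((MultilinearMap.mkPiAlgebra ℂ (Fin n) ℂ).compLinearMap
            (fun j => (innerSL ℂ (v j)).toLinearMap)).map_update_smul' u i c a
          simpa [algInnerAux_tprod, -MultilinearMap.map_update_smul] using h
        | smul c x hx => simp only [map_smul, smul_eq_mul, star_mul', hx]; ring
        | add x y hx hy => simp only [map_add, star_add, hx, hy, smul_add] }

/-- The inner product of the tensor power, conjugate linear in the first argument. -/
def algInner {n : ℕ} (x y : AlgTensor H n) : ℂ := star (algInnerLeft y x)

theorem algInner_tprod_left {n : ℕ} (u : Fin n → H) (y : AlgTensor H n) :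
    algInner (algTprod n u) y = algInnerAux u y := by
  simp [algInner, algInnerLeft, algLift_tprod]

/-- `⟪u 0 ⊗ ⋯ ⊗ u (n - 1), v 0 ⊗ ⋯ ⊗ v (n - 1)⟫ = ∏ j, ⟪u j, v j⟫`. -/
theorem algInner_tprod_tprod {n : ℕ} (u v : Fin n → H) :
    algInner (algTprod n u) (algTprod n v) = ∏ j, ⟪u j, v j⟫_ℂ := by
  rw [algInner_tprod_left, algInnerAux_tprod]

theorem algInner_add_left {n : ℕ} (x y z : AlgTensor H n) :
    algInner (x + y) z = algInner x z + algInner y z := by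
  simp [algInner]

theorem algInner_smul_left {n : ℕ} (c : ℂ) (x y : AlgTensor H n) :
    algInner (c • x) y = star c * algInner x y := by
  simp [algInner]

theorem algInner_add_right {n : ℕ} (x y z : AlgTensor H n) :
    algInner x (y + z) = algInner x y + algInner x z := by
  induction x using algTensor_induction with
  | tprod v => simp only [algInner_tprod_left, map_add]
  | smul c x hx => simp only [algInner_smul_left, hx, mul_add]
  | add x x' hx hx' => simp only [algInner_add_left, hx, hx']; ring

theorem algInner_smul_right {n : ℕ} (c : ℂ) (x y : AlgTensor H n) :
    algInner x (c • y) = c * algInner x y := by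
  induction x using algTensor_induction with
  | tprod v => simp only [algInner_tprod_left, map_smul, smul_eq_mul]
  | smul c x hx => simp only [algInner_smul_left, hx]; ring
  | add x x' hx hx' => simp only [algInner_add_left, hx, hx']; ring

theorem algInner_conj_symm {n : ℕ} (x y : AlgTensor H n) :
    star (algInner y x) = algInner x y := by
  induction x using algTensor_induction with
  | tprod u =>
    induction y using algTensor_induction with
    | tprod v => simp [algInner_tprod_tprod]
    | smul c y hy => simp only [algInner_smul_left, algInner_smul_right, star_mul', star_star, hy]
    | add y y' hy hy' => simp only [algInner_add_left, algInner_add_right, star_add, hy, hy']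
  | smul c x hx => simp only [algInner_smul_left, algInner_smul_right, star_mul', hx]
  | add x x' hx hx' => simp only [algInner_add_left, algInner_add_right, star_add, hx, hx']

theorem posSemidef_prod_gram {N : ℕ} {ι : Type*} (s : Finset ι) (v : Fin N → ι → H) :
    (Matrix.of fun i k : Fin N => ∏ j ∈ s, ⟪v i j, v k j⟫_ℂ).PosSemidef := by
  classical
  induction s using Finset.induction_on with
  | empty =>
    have h := Matrix.posSemidef_gram ℂ (fun _ : Fin N => (1 : ℂ))
    have e : (Matrix.of fun i k : Fin N => ∏ j ∈ (∅ : Finset ι), ⟪v i j, v k j⟫_ℂ)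
        = Matrix.gram ℂ (fun _ : Fin N => (1 : ℂ)) := by
      ext i k
      simp [Matrix.gram]
    rw [e]
    exact h
  | insert a s ha ih =>
    have h := (Matrix.posSemidef_gram ℂ (fun i => v i a)).hadamard ih
    have e : (Matrix.of fun i k : Fin N => ∏ j ∈ insert a s, ⟪v i j, v k j⟫_ℂ)
        = (Matrix.gram ℂ (fun i => v i a)).hadamard
          (Matrix.of fun i k : Fin N => ∏ j ∈ s, ⟪v i j, v k j⟫_ℂ) := by
      ext i k
      simp [Matrix.gram, Matrix.hadamard, Finset.prod_insert ha]
    rw [e]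
    exact h

theorem algInner_self_nonneg {n : ℕ} (x : AlgTensor H n) : 0 ≤ (algInner x x).re := by
  obtain ⟨N, c, v, rfl⟩ := algTensor_exists_sum x
  have hl : ∀ (s : Finset (Fin N)) (z : AlgTensor H n),
      algInner (∑ i ∈ s, c i • algTprod n (v i)) z
        = ∑ i ∈ s, star (c i) * algInner (algTprod n (v i)) z := by
    intro s z
    simp [algInner, map_sum]
  have hr : ∀ (i : Fin N), algInner (algTprod n (v i)) (∑ k, c k • algTprod n (v k))
        = ∑ k, c k * algInner (algTprod n (v i)) (algTprod n (v k)) := by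
    intro i
    simp [algInner_tprod_left, map_sum]
  have h := (posSemidef_prod_gram Finset.univ v).dotProduct_mulVec_nonneg c
  have e : algInner (∑ i, c i • algTprod n (v i)) (∑ i, c i • algTprod n (v i))
      = star c ⬝ᵥ (Matrix.of fun i k : Fin N => ∏ j, ⟪v i j, v k j⟫_ℂ).mulVec c := by
    rw [hl]
    simp only [hr, algInner_tprod_tprod, dotProduct, Matrix.mulVec, Pi.star_apply, Matrix.of_apply]
    refine Finset.sum_congr rfl fun i _ => ?_
    congr 1
    refine Finset.sum_congr rfl fun k _ => ?_
    ring
  rw [e]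
  exact (Complex.le_def.1 h).1

instance algTensorCore (n : ℕ) : PreInnerProductSpace.Core ℂ (AlgTensor H n) where
  inner := algInner
  conj_inner_symm x y := algInner_conj_symm x y
  re_inner_nonneg x := algInner_self_nonneg x
  add_left := algInner_add_left
  smul_left x y c := algInner_smul_left c x y

instance (n : ℕ) : SeminormedAddCommGroup (AlgTensor H n) :=
  InnerProductSpace.Core.toSeminormedAddCommGroup (𝕜 := ℂ)

instance (n : ℕ) : InnerProductSpace ℂ (AlgTensor H n) := .ofCore _

theorem inner_algTensor_eq {n : ℕ} (x y : AlgTensor H n) : ⟪x, y⟫_ℂ = algInner x y := rfl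

variable (H) in
/-- The `n`-th tensor power of the Hilbert space `H`, as a Hilbert space. -/
abbrev TensorPower (n : ℕ) : Type _ := UniformSpace.Completion (AlgTensor H n)

/-- The elementary tensor `v 0 ⊗ ⋯ ⊗ v (n - 1)` in the Hilbert space tensor power. -/
def tprod {n : ℕ} (v : Fin n → H) : TensorPower H n :=
  ((algTprod n v : AlgTensor H n) : UniformSpace.Completion (AlgTensor H n))

/-- `x ↦ u ⊗ x` on algebraic tensors. -/
def algTensorLeft (n : ℕ) (u : H) : AlgTensor H n →ₗ[ℂ] AlgTensor H (n + 1) :=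
  algLift ((algTprod (n + 1)).curryLeft u)

theorem algInner_algTensorLeft {n : ℕ} (u : H) (x y : AlgTensor H n) :
    algInner (algTensorLeft n u x) (algTensorLeft n u y) = ⟪u, u⟫_ℂ * algInner x y := by
  induction x using algTensor_induction with
  | tprod a =>
    induction y using algTensor_induction with
    | tprod b =>
      simp [algTensorLeft, algLift_tprod, algInner_tprod_tprod, Fin.prod_univ_succ]
    | smul c y hy => simp only [map_smul, algInner_smul_right, hy]; ring
    | add y y' hy hy' => simp only [map_add, algInner_add_right, hy, hy']; ring
  | smul c x hx => simp only [map_smul, algInner_smul_left, hx]; ring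
  | add x x' hx hx' => simp only [map_add, algInner_add_left, hx, hx']; ring

theorem norm_algTensorLeft {n : ℕ} (u : H) (x : AlgTensor H n) :
    ‖algTensorLeft n u x‖ = ‖u‖ * ‖x‖ := by
  have h := algInner_algTensorLeft u x x
  rw [← inner_algTensor_eq, ← inner_algTensor_eq, inner_self_eq_norm_sq_to_K,
    inner_self_eq_norm_sq_to_K, inner_self_eq_norm_sq_to_K, ← mul_pow] at h
  have h2 : ‖algTensorLeft n u x‖ ^ 2 = (‖u‖ * ‖x‖) ^ 2 := by exact_mod_cast h
  exact (pow_left_inj₀ (norm_nonneg _) (by positivity) two_ne_zero).1 h2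

/-- The bounded operator `x ↦ u ⊗ x` from `n`-fold to `(n + 1)`-fold tensors. -/
def tensorLeft (n : ℕ) (u : H) : TensorPower H n →L[ℂ] TensorPower H (n + 1) :=
  ((algTensorLeft n u).mkContinuous ‖u‖ fun x => (norm_algTensorLeft u x).le).completion

/-- `v 0 ⊗ ⋯ ⊗ v (n - 1) ↦ E v 0 ⊗ ⋯ ⊗ E v (n - 1)` on algebraic tensors,
for the orthogonal projection onto `E`. -/
def algProjTensor (E : Submodule ℂ H) [E.HasOrthogonalProjection] (n : ℕ) :
    AlgTensor H n →ₗ[ℂ] AlgTensor H n :=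
  algLift ((algTprod n).compLinearMap fun _ => E.starProjection.toLinearMap)

theorem algProjTensor_tprod (E : Submodule ℂ H) [E.HasOrthogonalProjection] (n : ℕ)
    (v : Fin n → H) :
    algProjTensor E n (algTprod n v) = algTprod n fun j => E.starProjection (v j) := by
  simp [algProjTensor, algLift_tprod]

theorem algInner_algProjTensor (E : Submodule ℂ H) [E.HasOrthogonalProjection] {n : ℕ}
    (x y : AlgTensor H n) :
    algInner (algProjTensor E n x) (algProjTensor E n y) = algInner x (algProjTensor E n y) := by
  induction x using algTensor_induction with
  | tprod a =>
    induction y using algTensor_induction with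
    | tprod b =>
      simp only [algProjTensor_tprod, algInner_tprod_tprod]
      refine Finset.prod_congr rfl fun j _ => ?_
      rw [Submodule.inner_starProjection_left_eq_right,
        Submodule.starProjection_eq_self_iff.2 (Submodule.starProjection_apply_mem _ _)]
    | smul c y hy => simp only [map_smul, algInner_smul_right, hy]
    | add y y' hy hy' => simp only [map_add, algInner_add_right, hy, hy']
  | smul c x hx => simp only [map_smul, algInner_smul_left, hx]
  | add x x' hx hx' => simp only [map_add, algInner_add_left, hx, hx']

theorem norm_algProjTensor_le (E : Submodule ℂ H) [E.HasOrthogonalProjection] {n : ℕ}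
    (x : AlgTensor H n) : ‖algProjTensor E n x‖ ≤ 1 * ‖x‖ := by
  have h : ⟪algProjTensor E n x, algProjTensor E n x⟫_ℂ = ⟪x, algProjTensor E n x⟫_ℂ :=
    algInner_algProjTensor E x x
  have h2 : ‖algProjTensor E n x‖ * ‖algProjTensor E n x‖ ≤ ‖x‖ * ‖algProjTensor E n x‖ := by
    calc ‖algProjTensor E n x‖ * ‖algProjTensor E n x‖
        = ‖⟪algProjTensor E n x, algProjTensor E n x⟫_ℂ‖ := by
          rw [inner_self_eq_norm_sq_to_K]; simp [sq]
      _ = ‖⟪x, algProjTensor E n x⟫_ℂ‖ := by rw [h]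
      _ ≤ ‖x‖ * ‖algProjTensor E n x‖ := norm_inner_le_norm _ _
  rw [one_mul]
  rcases (norm_nonneg (algProjTensor E n x)).eq_or_lt with h0 | h0
  · rw [← h0]; exact norm_nonneg _
  · exact le_of_mul_le_mul_right h2 h0

/-- The `n`-th tensor power of the orthogonal projection onto `E`. -/
def projTensor (E : Submodule ℂ H) [E.HasOrthogonalProjection] (n : ℕ) :
    TensorPower H n →L[ℂ] TensorPower H n :=
  ((algProjTensor E n).mkContinuous 1 fun x => norm_algProjTensor_le E x).completion

theorem projTensor_tprod (E : Submodule ℂ H) [E.HasOrthogonalProjection] {n : ℕ}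
    (v : Fin n → H) : projTensor E n (tprod v) = tprod fun j => E.starProjection (v j) := by
  simp [projTensor, tprod, algProjTensor_tprod]

theorem norm_projTensor_le (E : Submodule ℂ H) [E.HasOrthogonalProjection] {n : ℕ}
    (x : TensorPower H n) : ‖projTensor E n x‖ ≤ ‖x‖ := by
  induction x using UniformSpace.Completion.induction_on with
  | hp => exact isClosed_le (by fun_prop) (by fun_prop)
  | ih x => simpa [projTensor] using norm_algProjTensor_le E x

end TensorPower

/-! ### Symmetric Fock space -/

section Fock

variable {H : Type*} [NormedAddCommGroup H] [InnerProductSpace ℂ H]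

/-- The symmetric product `v 0 ∘ ⋯ ∘ v (n - 1) = (1 / n!) ∑ σ, v (σ 0) ⊗ ⋯ ⊗ v (σ (n - 1))`. -/
def symProd {n : ℕ} (v : Fin n → H) : TensorPower H n :=
  ((n.factorial : ℂ)⁻¹) • ∑ σ : Equiv.Perm (Fin n), tprod fun j => v (σ j)

variable (H) in
/-- The `n`-th symmetric tensor power of the Hilbert space `H`. -/
def SymPower (n : ℕ) : Submodule ℂ (TensorPower H n) :=
  (Submodule.span ℂ (Set.range (symProd : (Fin n → H) → TensorPower H n))).topologicalClosure

instance (n : ℕ) : CompleteSpace (SymPower H n) :=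
  Submodule.topologicalClosure.completeSpace _

theorem symProd_mem {n : ℕ} (v : Fin n → H) : symProd v ∈ SymPower H n :=
  Submodule.le_topologicalClosure _ (Submodule.subset_span ⟨v, rfl⟩)

variable (H) in
/-- The symmetric Fock space over `H`: the Hilbert space direct sum of the symmetric tensor powers
of `H`, the summand with index `0` being the vacuum sector. -/
abbrev Fock : Type _ := lp (fun n : ℕ => SymPower H n) 2

/-- The symmetric product `v 0 ∘ ⋯ ∘ v (n - 1)` as an element of the Fock space. For `n = 0`
this is the vacuum vector. -/
def prodVec {n : ℕ} (v : Fin n → H) : Fock H :=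
  lp.single 2 n (⟨symProd v, symProd_mem v⟩ : SymPower H n)

variable (H) in
/-- The finite particle domain: the linear span of all `v₁ ∘ ⋯ ∘ vₙ`, including the vacuum. -/
def finiteParticle : Submodule ℂ (Fock H) :=
  Submodule.span ℂ {x | ∃ (n : ℕ) (v : Fin n → H), x = prodVec v}

/-- The creation operator on `n`-particle vectors, `x ↦ √(n + 1) Sym (u ⊗ x)`, where `Sym` is the
orthogonal projection onto the symmetric tensors. -/
def creationLevel (u : H) (n : ℕ) : SymPower H n →L[ℂ] SymPower H (n + 1) :=
  ((Real.sqrt (n + 1) : ℝ) : ℂ) •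
    ((SymPower H (n + 1)).orthogonalProjectionOnto ∘L tensorLeft n u ∘L (SymPower H n).subtypeL)

/-- The annihilation operator on `(n + 1)`-particle vectors: `√(n + 1)` times the contraction of
the first tensor factor with `u`. The contraction is the adjoint of `x ↦ u ⊗ x`; it maps symmetric
tensors to symmetric tensors, so that the projection onto them does not change its value. -/
def annihilationLevel (u : H) (n : ℕ) : SymPower H (n + 1) →L[ℂ] SymPower H n :=
  ((Real.sqrt (n + 1) : ℝ) : ℂ) •
    ((SymPower H n).orthogonalProjectionOnto ∘L (tensorLeft n u).adjoint ∘L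
      (SymPower H (n + 1)).subtypeL)

/-- The sequence of components of `a*(u) x`. -/
def creationSeq (u : H) : Fock H →ₗ[ℂ] (∀ n : ℕ, SymPower H n) where
  toFun x := fun n => match n with
    | 0 => 0
    | n + 1 => creationLevel u n (x n)
  map_add' x y := by ext n; cases n <;> simp
  map_smul' c x := by ext n; cases n <;> simp

/-- The sequence of components of `a(u) x`. -/
def annihilationSeq (u : H) : Fock H →ₗ[ℂ] (∀ n : ℕ, SymPower H n) where
  toFun x := fun n => annihilationLevel u n (x (n + 1))
  map_add' x y := by ext n; simp
  map_smul' c x := by ext n; simp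

/-- The operator on the Fock space with the given components, on its maximal domain. -/
def ofSeq (T : Fock H →ₗ[ℂ] (∀ n : ℕ, SymPower H n)) : Fock H →ₗ.[ℂ] Fock H where
  domain :=
    { carrier := {x | Memℓp (T x) 2}
      add_mem' := fun {x y} hx hy => by
        have h := Memℓp.add hx hy
        simpa only [Set.mem_ofPred_eq, map_add] using h
      zero_mem' := by
        have h : Memℓp (0 : ∀ n : ℕ, SymPower H n) 2 := zero_memℓp
        simpa only [Set.mem_ofPred_eq, map_zero] using h
      smul_mem' := fun c x hx => by
        have h := Memℓp.const_smul hx c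
        simpa only [Set.mem_ofPred_eq, map_smul] using h }
  toFun :=
    { toFun := fun x => ⟨T x, x.2⟩
      map_add' := fun x y => Subtype.ext (by simp; rfl)
      map_smul' := fun c x => Subtype.ext (by simp; rfl) }

/-- The boson creation operator `a*(u)`. -/
def creation (u : H) : Fock H →ₗ.[ℂ] Fock H := ofSeq (creationSeq u)

/-- The boson annihilation operator `a(u)`. -/
def annihilation (u : H) : Fock H →ₗ.[ℂ] Fock H := ofSeq (annihilationSeq u)

theorem projTensor_symProd (E : Submodule ℂ H) [E.HasOrthogonalProjection] {n : ℕ}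
    (v : Fin n → H) : projTensor E n (symProd v) = symProd fun j => E.starProjection (v j) := by
  simp only [symProd, map_smul, map_sum, projTensor_tprod]

theorem projTensor_mem_symPower (E : Submodule ℂ H) [E.HasOrthogonalProjection] {n : ℕ}
    {x : TensorPower H n} (hx : x ∈ SymPower H n) : projTensor E n x ∈ SymPower H n := by
  have hs : ∀ y ∈ Submodule.span ℂ (Set.range (symProd : (Fin n → H) → TensorPower H n)),
      projTensor E n y ∈ Submodule.span ℂ (Set.range (symProd : (Fin n → H) → TensorPower H n)) := by
    intro y hy
    induction hy using Submodule.span_induction with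
    | mem y h =>
      obtain ⟨v, rfl⟩ := h
      rw [projTensor_symProd]
      exact Submodule.subset_span ⟨_, rfl⟩
    | zero => rw [map_zero]; exact Submodule.zero_mem _
    | add y z _ _ hy hz => rw [map_add]; exact Submodule.add_mem _ hy hz
    | smul c y _ hy => rw [map_smul]; exact Submodule.smul_mem _ c hy
  exact map_mem_closure (projTensor E n).continuous hx hs

/-- The `n`-th tensor power of the orthogonal projection onto `E`, on symmetric tensors. -/
def projSym (E : Submodule ℂ H) [E.HasOrthogonalProjection] (n : ℕ) :
    SymPower H n →L[ℂ] SymPower H n :=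
  (projTensor E n ∘L (SymPower H n).subtypeL).codRestrict (SymPower H n)
    fun x => projTensor_mem_symPower E x.2

theorem norm_projSym_le (E : Submodule ℂ H) [E.HasOrthogonalProjection] {n : ℕ}
    (x : SymPower H n) : ‖projSym E n x‖ ≤ ‖x‖ :=
  norm_projTensor_le E (x : TensorPower H n)

/-- The second quantization of the orthogonal projection onto the subspace `E` of `H`: it acts on
`n`-particle vectors as the `n`-th tensor power of that projection. -/
def secondQuant (E : Submodule ℂ H) [E.HasOrthogonalProjection] : Fock H →L[ℂ] Fock H :=
  LinearMap.mkContinuous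
    { toFun := fun x => ⟨fun n => projSym E n (x n),
        (lp.memℓp x).mono' fun n => norm_projSym_le E (x n)⟩
      map_add' := fun x y => by ext n; simp; rfl
      map_smul' := fun c x => by ext n; simp } 1 fun x => by
    rw [one_mul]
    refine lp.norm_le_of_tsum_le (by norm_num) (norm_nonneg _) ?_
    rw [lp.norm_rpow_eq_tsum (by norm_num)]
    refine Summable.tsum_le_tsum (fun n => ?_) ?_ ((lp.memℓp x).summable (by norm_num))
    · exact Real.rpow_le_rpow (norm_nonneg _) (norm_projSym_le E (x n)) (by norm_num)
    · exact ((lp.memℓp x).mono' fun n => norm_projSym_le E (x n)).summable (by norm_num)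

end Fock

/-! ### Products and strongly convergent series of operators -/

/-- The product `A B` of a partially defined operator `A` and a bounded operator `B`, on the domain
of all `x` such that `B x` is in the domain of `A`. -/
def compBounded {V : Type*} [NormedAddCommGroup V] [NormedSpace ℂ V] (A : V →ₗ.[ℂ] V)
    (B : V →L[ℂ] V) : V →ₗ.[ℂ] V where
  domain := A.domain.comap B.toLinearMap
  toFun := A.toFun ∘ₗ B.toLinearMap.restrict (p := A.domain.comap B.toLinearMap)
    (q := A.domain) fun _ hx => hx

/-- The operator `x ↦ ∑ i, T i x`, where the series is understood as strongly convergent, on the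
domain of all `x` that belong to the domain of every `T i` and for which the series converges. -/
def strongSum {V ι : Type*} [NormedAddCommGroup V] [NormedSpace ℂ V] (T : ι → (V →ₗ.[ℂ] V)) :
    V →ₗ.[ℂ] V where
  domain :=
    { carrier := {x | ∃ h : ∀ i, x ∈ (T i).domain, Summable fun i => T i ⟨x, h i⟩}
      add_mem' := by
        rintro x y ⟨hx, sx⟩ ⟨hy, sy⟩
        refine ⟨fun i => Submodule.add_mem _ (hx i) (hy i), (sx.add sy).congr fun i => ?_⟩
        exact ((T i).map_add ⟨x, hx i⟩ ⟨y, hy i⟩).symm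
      zero_mem' := by
        refine ⟨fun i => Submodule.zero_mem _, summable_zero.congr fun i => ?_⟩
        exact (T i).map_zero.symm
      smul_mem' := by
        rintro c x ⟨hx, sx⟩
        refine ⟨fun i => Submodule.smul_mem _ c (hx i), (sx.const_smul c).congr fun i => ?_⟩
        exact ((T i).map_smul c ⟨x, hx i⟩).symm }
  toFun :=
    { toFun := fun x => ∑' i, T i ⟨x, x.2.1 i⟩
      map_add' := by
        rintro ⟨x, hx, sx⟩ ⟨y, hy, sy⟩
        refine Eq.trans ?_ (sx.tsum_add sy)
        exact tsum_congr fun i => (T i).map_add ⟨x, hx i⟩ ⟨y, hy i⟩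
      map_smul' := by
        rintro c ⟨x, hx, sx⟩
        refine Eq.trans ?_ (sx.tsum_const_smul c)
        exact tsum_congr fun i => (T i).map_smul c ⟨x, hx i⟩ }

/-! ### Filtered operators on the multiple symmetric Fock space -/

section Filtered

/-- The space `K = L²(ℝ₊)`. -/
abbrev KSpace : Type := Lp ℂ 2 (volume.restrict (Set.Ici (0 : ℝ)))

variable {G : Type*} [NormedAddCommGroup G] [InnerProductSpace ℂ G]

variable (G) in
/-- The space `H = L²(ℝ₊, G)`, which is the Hilbert space tensor product of `K` and `G`. -/
abbrev HSpace : Type _ := Lp G 2 (volume.restrict (Set.Ici (0 : ℝ)))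

/-- The vector `f ⊗ g` of `H`, i.e. the function `t ↦ f t • g`. -/
def elemTensor (f : KSpace) (g : G) : HSpace G :=
  (ContinuousLinearMap.toSpanSingleton ℂ g).compLp f

variable [CompleteSpace G] (e : HilbertBasis ℕ+ ℂ G)

/-- The closed subspace of `H` of all vectors whose colors belong to the filter `σ`. -/
def filterSpace (σ : Set ℕ+) : Submodule ℂ (HSpace G) :=
  (Submodule.span ℂ {u | ∃ (f : KSpace) (k : ℕ+), k ∈ σ ∧ u = elemTensor f (e k)}).topologicalClosure

instance (σ : Set ℕ+) : CompleteSpace (filterSpace e σ) :=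
  Submodule.topologicalClosure.completeSpace _

/-- The projection `P^(σ)`: the second quantization of the projection of `H` onto the subspace
of the filter `σ`. -/
def filterProj (σ : Set ℕ+) : Fock (HSpace G) →L[ℂ] Fock (HSpace G) :=
  secondQuant (filterSpace e σ)

/-- The projection `P^(r)`: for `r ≥ 1` it is `P^(σ)` with the filter `σ = {1, …, r - 1}`
(so `P^(1)` is the projection onto the vacuum), and `P^(0) = 0`. -/
def levelProj (r : ℕ) : Fock (HSpace G) →L[ℂ] Fock (HSpace G) :=
  if r = 0 then 0 else filterProj e {k | (k : ℕ) < r}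

/-- `P^(m)` for `m ∈ ℕ ∪ {∞}`, with `P^(∞) = I`. -/
def orderProj : ℕ∞ → (Fock (HSpace G) →L[ℂ] Fock (HSpace G))
  | ⊤ => ContinuousLinearMap.id ℂ _
  | (r : ℕ) => levelProj e r

/-- The filtered creation operator `a^(r)*(f ⊗ e_k) = a*(f ⊗ e_k) P^(r)`. -/
def filteredCreation (r : ℕ) (f : KSpace) (k : ℕ+) :
    Fock (HSpace G) →ₗ.[ℂ] Fock (HSpace G) :=
  compBounded (creation (elemTensor f (e k))) (levelProj e r)

/-- The filtered annihilation operator `a^(r)(f ⊗ e_k) = P^(r) a(f ⊗ e_k)`, on the domain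
of `a(f ⊗ e_k)`. -/
def filteredAnnihilation (r : ℕ) (f : KSpace) (k : ℕ+) :
    Fock (HSpace G) →ₗ.[ℂ] Fock (HSpace G) :=
  (levelProj e r).toLinearMap.compPMap (annihilation (elemTensor f (e k)))

/-- The extended `m`-free creation operator
`l^(m)*(f) = ∑_{k=1}^m (a^(k)*(f ⊗ e_k) - a^(k-1)*(f ⊗ e_k))`. -/
def extCreation (m : ℕ∞) (f : KSpace) : Fock (HSpace G) →ₗ.[ℂ] Fock (HSpace G) :=
  strongSum fun k : {k : ℕ+ // ((k : ℕ) : ℕ∞) ≤ m} =>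
    filteredCreation e (k.1 : ℕ) f k - filteredCreation e ((k.1 : ℕ) - 1) f k

/-- The extended `m`-free annihilation operator
`l^(m)(f) = ∑_{k=1}^m (a^(k)(f ⊗ e_k) - a^(k-1)(f ⊗ e_k))`. -/
def extAnnihilation (m : ℕ∞) (f : KSpace) : Fock (HSpace G) →ₗ.[ℂ] Fock (HSpace G) :=
  strongSum fun k : {k : ℕ+ // ((k : ℕ) : ℕ∞) ≤ m} =>
    filteredAnnihilation e (k.1 : ℕ) f k - filteredAnnihilation e ((k.1 : ℕ) - 1) f k

/-- The linear span of the vacuum and the vectors `(f₁ ⊗ e_{k₁}) ∘ ⋯ ∘ (fₙ ⊗ e_{kₙ})`. -/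
def coloredParticle : Submodule ℂ (Fock (HSpace G)) :=
  Submodule.span ℂ {x | ∃ (n : ℕ) (f : Fin n → KSpace) (k : Fin n → ℕ+),
    x = prodVec fun j => elemTensor (f j) (e (k j))}

/-- `L` is the unique bounded extension of `T` to the whole Fock space. The operator `T` is defined
on the finite particle domain at least, and `L` extends it from its whole domain; and already
the values on the vectors of finitely many colors determine `L`. -/
structure IsUniqueBoundedExtension (T : Fock (HSpace G) →ₗ.[ℂ] Fock (HSpace G))
    (L : Fock (HSpace G) →L[ℂ] Fock (HSpace G)) : Prop where
  finiteParticle_le : finiteParticle (HSpace G) ≤ T.domain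
  extends_op : ∀ x : T.domain, L x = T x
  unique : ∀ L' : Fock (HSpace G) →L[ℂ] Fock (HSpace G),
    (∀ x : T.domain, (x : Fock (HSpace G)) ∈ coloredParticle e → L' x = T x) → L' = L

end Filtered

end FilteredFock

end

/-! Put `D_k = P^(k) - P^(k-1)`. Since `P^(0) = 0` and the `P^(k)` increase to the identity, the
`D_k` are mutually orthogonal projections whose sum over `k ≤ m` is `P^(m)`, strongly if `m = ∞`.
The `k`-th term of `l^(m)*(f)` is `a*(f ⊗ e_k) D_k`, and `D_k` only leaves particles of colors below
`k`, all orthogonal to `f ⊗ e_k`.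

The unbounded operator `a*(w)` is harmless on the Fock space over a subspace `E` orthogonal to `w`.
In the commutation relation `a(w) a*(u) = ⟪w, u⟫ + a*(u) a(w)` the last summand vanishes there, so
that `⟪a*(w) x, a*(u) y⟫ = ⟪w, u⟫ ⟪x, y⟫`. In terms of tensors, only the permutations fixing the new
particle survive (`inner_tprod_cons_symProd_cons`, `inner_creationProj_creationProj`). Consequently
different terms of the series have orthogonal ranges, and `⟪l^(m)*(g) x, l^(m)*(f) y⟫ = ⟪g, f⟫ ⟪x,
P^(m) y⟫` (`inner_creationTerm`, `inner_tsum_creationTerm`).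

This identity yields the upper norm bound and the product formula, once `l^(m)(g)` is known to be
the adjoint of `l^(m)*(g)`; the vacuum shows that the bound is attained. The annihilation series
converges to the adjoint because its `k`-th term is `D_k` applied to the adjoint
(`hasSum_adjoint_creationTerm`). Uniqueness is the density of the span of colored products
(`topologicalClosure_coloredParticle`). -/

noncomputable section

namespace FilteredFock

/-! ### Norms and orthogonal series in Hilbert spaces. -/

section Hilbert

variable {U V W ι : Type*} [NormedAddCommGroup V] [InnerProductSpace ℂ V] [NormedAddCommGroup W]
  [InnerProductSpace ℂ W] [NormedAddCommGroup U] [InnerProductSpace ℂ U]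

theorem norm_eq_of_inner_self_eq_mul {x : U} {y : V} {a : W}
    (h : ⟪x, x⟫_ℂ = ⟪a, a⟫_ℂ * ⟪y, y⟫_ℂ) : ‖x‖ = ‖a‖ * ‖y‖ := by
  simp only [inner_self_eq_norm_sq_to_K, ← mul_pow] at h
  have h2 : ‖x‖ ^ 2 = (‖a‖ * ‖y‖) ^ 2 := by exact_mod_cast h
  exact (pow_left_inj₀ (norm_nonneg _) (by positivity) two_ne_zero).1 h2

/-- Cauchy–Schwarz; in the application `z` is `P^(m) y`, of which only contractivity is needed. -/
theorem norm_le_of_inner_self_eq_mul {x : U} {y z : V} {a : W} (hz : ‖z‖ ≤ ‖y‖)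
    (h : ⟪x, x⟫_ℂ = ⟪a, a⟫_ℂ * ⟪y, z⟫_ℂ) : ‖x‖ ≤ ‖a‖ * ‖y‖ := by
  refine (pow_le_pow_iff_left₀ (norm_nonneg _) (by positivity) two_ne_zero).1 ?_
  have h2 := congrArg norm h
  simp only [inner_self_eq_norm_sq_to_K, norm_mul, norm_pow, RCLike.norm_ofReal, abs_norm] at h2
  rw [h2, mul_pow, sq ‖y‖]
  gcongr
  exact (norm_inner_le_norm _ _).trans (by gcongr)

theorem hasSum_inner_right {a : ι → V} {s : V} (h : HasSum a s) (x : V) :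
    HasSum (fun k => ⟪x, a k⟫_ℂ) ⟪x, s⟫_ℂ :=
  (innerSL ℂ x).hasSum h

theorem hasSum_inner_left {a : ι → V} {s : V} (h : HasSum a s) (x : V) :
    HasSum (fun k => ⟪a k, x⟫_ℂ) ⟪s, x⟫_ℂ :=
  (innerSLFlip ℂ x).hasSum h

theorem summable_of_orthogonal [CompleteSpace V] {a : ι → V}
    (ha : ∀ j k, j ≠ k → ⟪a j, a k⟫_ℂ = 0) (hs : Summable fun k => ‖a k‖ ^ 2) : Summable a := by
  -- Passing to the lines spanned by the `a k` allows some of the vectors to vanish.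
  have hV : OrthogonalFamily ℂ (fun k => ℂ ∙ a k) fun k => (ℂ ∙ a k).subtypeₗᵢ := by
    intro j k hjk x y
    obtain ⟨c, hc⟩ := Submodule.mem_span_singleton.1 x.2
    obtain ⟨d, hd⟩ := Submodule.mem_span_singleton.1 y.2
    simp [← hc, ← hd, inner_smul_left, inner_smul_right, ha j k hjk]
  exact (hV.summable_iff_norm_sq_summable
    fun k => ⟨a k, Submodule.mem_span_singleton_self _⟩).2 hs

end Hilbert

/-! ### Symmetrization of tensors and tensor powers of projections. -/

section Tensors

variable {H : Type*} [NormedAddCommGroup H] [InnerProductSpace ℂ H]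

@[elab_as_elim]
-- Algebraic tensors are dense, so identities that are linear and continuous need checking on
-- elementary tensors only.
theorem tensorPower_induction {n : ℕ} {p : TensorPower H n → Prop} (x : TensorPower H n)
    (closed : IsClosed {x | p x}) (tprod : ∀ v, p (tprod v))
    (smul : ∀ (c : ℂ) x, p x → p (c • x)) (add : ∀ x y, p x → p y → p (x + y)) : p x := by
  induction x using UniformSpace.Completion.induction_on with
  | hp => exact closed
  | ih x =>
    induction x using algTensor_induction with
    | tprod v => exact tprod v
    | smul c x hx => rw [UniformSpace.Completion.coe_smul]; exact smul c _ hx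
    | add x y hx hy => rw [UniformSpace.Completion.coe_add]; exact add _ _ hx hy

theorem inner_tprod {n : ℕ} (u v : Fin n → H) : ⟪tprod u, tprod v⟫_ℂ = ∏ j, ⟪u j, v j⟫_ℂ := by
  rw [tprod, tprod, UniformSpace.Completion.inner_coe, inner_algTensor_eq, algInner_tprod_tprod]

theorem tensorLeft_tprod {n : ℕ} (u : H) (v : Fin n → H) :
    tensorLeft n u (tprod v) = tprod (Fin.cons u v : Fin (n + 1) → H) := by
  simp only [tensorLeft, tprod, ContinuousLinearMap.completion_apply_coe,
    LinearMap.mkContinuous_apply, algTensorLeft, algLift_tprod, MultilinearMap.curryLeft_apply]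

theorem norm_tprod {n : ℕ} (v : Fin n → H) : ‖tprod v‖ = ∏ j, ‖v j‖ := by
  have h : ‖tprod v‖ ^ 2 = (∏ j, ‖v j‖) ^ 2 := by
    have h := inner_tprod v v
    simp only [inner_self_eq_norm_sq_to_K, Finset.prod_pow] at h
    exact_mod_cast h
  exact (pow_left_inj₀ (norm_nonneg _) (by positivity) two_ne_zero).1 h

/-- Elementary tensors, as a continuous multilinear map. -/
def tprodMultilinear (n : ℕ) : ContinuousMultilinearMap ℂ (fun _ : Fin n => H) (TensorPower H n) :=
  ((UniformSpace.Completion.toComplₗᵢ (𝕜 := ℂ) (E := AlgTensor H n)).toLinearMap.compMultilinearMap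
    (algTprod n)).mkContinuous 1 fun v => by
      rw [one_mul]
      exact (norm_tprod v).le

theorem inner_symProd_tprod {n : ℕ} (u v : Fin n → H) :
    ⟪symProd u, tprod v⟫_ℂ
      = (n.factorial : ℂ)⁻¹ * ∑ σ : Equiv.Perm (Fin n), ∏ j, ⟪u (σ j), v j⟫_ℂ := by
  simp [symProd, inner_smul_left, sum_inner, inner_tprod]

theorem inner_symProd_tprod_perm {n : ℕ} (u v : Fin n → H) (τ : Equiv.Perm (Fin n)) :
    ⟪symProd u, tprod fun j => v (τ j)⟫_ℂ = ⟪symProd u, tprod v⟫_ℂ := by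
  rw [inner_symProd_tprod, inner_symProd_tprod]
  congr 1
  -- Replacing `σ` by `σ τ⁻¹` and the factor index `j` by `τ j` turns one sum into the other.
  refine Fintype.sum_equiv (Equiv.mulRight τ⁻¹) _ _ fun σ => ?_
  refine Fintype.prod_equiv τ _ _ fun j => ?_
  simp

theorem inner_symProd_symProd {n : ℕ} (u v : Fin n → H) :
    ⟪symProd u, symProd v⟫_ℂ = ⟪symProd u, tprod v⟫_ℂ := by
  conv_lhs => rw [symProd.eq_def v]
  rw [inner_smul_right, inner_sum]
  simp only [inner_symProd_tprod_perm]
  rw [Finset.sum_const, Finset.card_univ, Fintype.card_perm, Fintype.card_fin, nsmul_eq_mul,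
    inv_mul_cancel_left₀ (by exact_mod_cast n.factorial_ne_zero)]

/-- All permuted tensors have the same scalar product with a given `symProd u`, hence so does their
average. Thus the error `tprod v - symProd v` is orthogonal to the closed span of symmetric
products. This makes the abstract projection in `creationLevel` computable. -/
theorem starProjection_symPower_tprod {n : ℕ} (v : Fin n → H) :
    (SymPower H n).starProjection (tprod v) = symProd v := by
  refine Submodule.eq_starProjection_of_mem_of_inner_eq_zero (symProd_mem v) fun w hw => ?_
  rw [← inner_eq_zero_symm]
  refine closure_minimal (t := {w | ⟪w, tprod v - symProd v⟫_ℂ = 0}) (fun w hw => ?_)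
    (isClosed_eq (by fun_prop) continuous_const) hw
  change w ∈ Submodule.span ℂ _ at hw
  induction hw using Submodule.span_induction with
  | mem w h =>
    obtain ⟨u, rfl⟩ := h
    simp [inner_sub_right, inner_symProd_symProd]
  | zero => simp
  | add y z _ _ hy hz => simp_all [inner_add_left]
  | smul c y _ hy => simp_all [inner_smul_left]

theorem inner_tprod_symProd {n : ℕ} (u v : Fin n → H) :
    ⟪tprod u, symProd v⟫_ℂ
      = (n.factorial : ℂ)⁻¹ * ∑ σ : Equiv.Perm (Fin n), ∏ j, ⟪u j, v (σ j)⟫_ℂ := by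
  simp [symProd, inner_smul_right, inner_sum, inner_tprod]

/-- If `w` is orthogonal to all `v j`, only the permutations that fix the first factor contribute
to the scalar product of `w ⊗ a 0 ⊗ ⋯` with `u ∘ v 0 ∘ ⋯`. -/
theorem inner_tprod_cons_symProd_cons {n : ℕ} (w u : H) (a v : Fin n → H)
    (h : ∀ j, ⟪w, v j⟫_ℂ = 0) :
    ((n : ℂ) + 1) * ⟪tprod (Fin.cons w a : Fin (n + 1) → H),
        symProd (Fin.cons u v : Fin (n + 1) → H)⟫_ℂ
      = ⟪w, u⟫_ℂ * ⟪tprod a, symProd v⟫_ℂ := by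
  have hs : ∑ σ : Equiv.Perm (Fin (n + 1)), ∏ j, ⟪(Fin.cons w a : Fin (n + 1) → H) j,
        (Fin.cons u v : Fin (n + 1) → H) (σ j)⟫_ℂ
      = ⟪w, u⟫_ℂ * ∑ σ : Equiv.Perm (Fin n), ∏ j, ⟪a j, v (σ j)⟫_ℂ := by
    -- A permutation of `Fin (n + 1)` is encoded by its value at `0` and a permutation of `Fin n`. A
    -- nonzero value at `0` pairs `w` with some `v j` and contributes nothing.
    rw [← Equiv.sum_comp Equiv.Perm.decomposeFin.symm, Fintype.sum_prod_type, Fin.sum_univ_succ]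
    simp [Fin.prod_univ_succ, Equiv.Perm.decomposeFin_symm_apply_succ, h, Finset.mul_sum]
  have hn : ((n : ℂ) + 1) ≠ 0 := by exact_mod_cast n.succ_ne_zero
  have hf : (n.factorial : ℂ) ≠ 0 := by exact_mod_cast n.factorial_ne_zero
  rw [inner_tprod_symProd, inner_tprod_symProd, hs, Nat.factorial_succ]
  push_cast
  field_simp

/-- Inserting `projTensor E n` makes the orthogonality required by `inner_tprod_cons_symProd_cons`
automatic, so both tensors may be arbitrary and the density argument applies. Only `w`, not `u`, has
to be orthogonal to `E`. -/
theorem inner_tensorLeft_symProj (E : Submodule ℂ H) [E.HasOrthogonalProjection] {n : ℕ} {w : H}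
    (hw : w ∈ Eᗮ) (u : H) (x z : TensorPower H n) :
    ((n : ℂ) + 1) * ⟪tensorLeft n w x,
        (SymPower H (n + 1)).starProjection (tensorLeft n u (projTensor E n z))⟫_ℂ
      = ⟪w, u⟫_ℂ * ⟪x, (SymPower H n).starProjection (projTensor E n z)⟫_ℂ := by
  induction z using tensorPower_induction with
  | closed => exact isClosed_eq (by fun_prop) (by fun_prop)
  | tprod v =>
    induction x using tensorPower_induction with
    | closed => exact isClosed_eq (by fun_prop) (by fun_prop)
    | tprod a =>
      rw [projTensor_tprod, tensorLeft_tprod, tensorLeft_tprod, starProjection_symPower_tprod,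
        starProjection_symPower_tprod]
      exact inner_tprod_cons_symProd_cons w u a _ fun j =>
        Submodule.inner_left_of_mem_orthogonal (Submodule.starProjection_apply_mem _ _) hw
    | smul c x hx =>
      simp only [map_smul, inner_smul_left]
      linear_combination (starRingEnd ℂ c) * hx
    | add x y hx hy => simp only [map_add, inner_add_left]; linear_combination hx + hy
  | smul c z hz => simp only [map_smul, inner_smul_right]; linear_combination c * hz
  | add z z' hz hz' => simp only [map_add, inner_add_right]; linear_combination hz + hz'

theorem projTensor_projTensor {E F : Submodule ℂ H} [E.HasOrthogonalProjection]
    [F.HasOrthogonalProjection] (h : E ≤ F) {n : ℕ} (x : TensorPower H n) :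
    projTensor F n (projTensor E n x) = projTensor E n x := by
  induction x using tensorPower_induction with
  | closed => exact isClosed_eq (by fun_prop) (by fun_prop)
  | tprod v =>
    simp only [projTensor_tprod]
    congr 1
    ext j
    exact Submodule.starProjection_eq_self_iff.2 (h (Submodule.starProjection_apply_mem _ _))
  | smul c x hx => simp only [map_smul, hx]
  | add x y hx hy => simp only [map_add, hx, hy]

theorem inner_projTensor_left (E : Submodule ℂ H) [E.HasOrthogonalProjection] {n : ℕ}
    (x y : TensorPower H n) : ⟪projTensor E n x, y⟫_ℂ = ⟪x, projTensor E n y⟫_ℂ := by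
  induction y using tensorPower_induction with
  | closed => exact isClosed_eq (by fun_prop) (by fun_prop)
  | tprod v =>
    induction x using tensorPower_induction with
    | closed => exact isClosed_eq (by fun_prop) (by fun_prop)
    | tprod a => simp only [projTensor_tprod, inner_tprod,
        Submodule.inner_starProjection_left_eq_right]
    | smul c x hx => simp only [map_smul, inner_smul_left, hx]
    | add x y hx hy => simp only [map_add, inner_add_left, hx, hy]
  | smul c z hz => simp only [map_smul, inner_smul_right, hz]
  | add z z' hz hz' => simp only [map_add, inner_add_right, hz, hz']

/-! ### Second quantized projections, creation and annihilation on the Fock space. -/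

theorem secondQuant_apply (E : Submodule ℂ H) [E.HasOrthogonalProjection] (x : Fock H) (n : ℕ) :
    secondQuant E x n = projSym E n (x n) := rfl

theorem secondQuant_secondQuant {E F : Submodule ℂ H} [E.HasOrthogonalProjection]
    [F.HasOrthogonalProjection] (h : E ≤ F) (x : Fock H) :
    secondQuant F (secondQuant E x) = secondQuant E x := by
  ext n
  exact projTensor_projTensor h _

theorem inner_secondQuant_left (E : Submodule ℂ H) [E.HasOrthogonalProjection] (x y : Fock H) :
    ⟪secondQuant E x, y⟫_ℂ = ⟪x, secondQuant E y⟫_ℂ := by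
  rw [lp.inner_eq_tsum, lp.inner_eq_tsum]
  exact tsum_congr fun n => inner_projTensor_left E _ _

theorem secondQuant_prodVec (E : Submodule ℂ H) [E.HasOrthogonalProjection] {n : ℕ}
    (v : Fin n → H) : secondQuant E (prodVec v) = prodVec fun j => E.starProjection (v j) := by
  ext m
  rw [secondQuant_apply, prodVec, prodVec]
  rcases eq_or_ne m n with rfl | hm
  · rw [lp.single_apply_self, lp.single_apply_self]
    exact projTensor_symProd E v
  · rw [lp.single_apply_ne _ _ _ hm, lp.single_apply_ne _ _ _ hm, map_zero]

theorem inner_symPower {n : ℕ} (x y : SymPower H n) :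
    ⟪x, y⟫_ℂ = ⟪(x : TensorPower H n), (y : TensorPower H n)⟫_ℂ := rfl

theorem coe_creationLevel (u : H) (n : ℕ) (x : SymPower H n) :
    (creationLevel u n x : TensorPower H (n + 1)) = ((Real.sqrt (n + 1) : ℝ) : ℂ) •
      (SymPower H (n + 1)).starProjection (tensorLeft n u x) := rfl

theorem coe_annihilationLevel (u : H) (n : ℕ) (x : SymPower H (n + 1)) :
    (annihilationLevel u n x : TensorPower H n) = ((Real.sqrt (n + 1) : ℝ) : ℂ) •
      (SymPower H n).starProjection ((tensorLeft n u).adjoint x) := rfl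

/-- The projections in both operators are self-adjoint and fix the symmetric vectors `x` and `y`;
what remains is the adjoint of `tensorLeft n u`. -/
theorem inner_creationLevel_right (u : H) (n : ℕ) (x : SymPower H (n + 1)) (y : SymPower H n) :
    ⟪x, creationLevel u n y⟫_ℂ = ⟪annihilationLevel u n x, y⟫_ℂ := by
  rw [inner_symPower, inner_symPower, coe_creationLevel, coe_annihilationLevel, inner_smul_left,
    inner_smul_right, Complex.conj_ofReal,
    Submodule.inner_starProjection_left_eq_right (SymPower H n),
    ← Submodule.inner_starProjection_left_eq_right (SymPower H (n + 1)),
    Submodule.starProjection_mem_subspace_eq_self, Submodule.starProjection_mem_subspace_eq_self,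
    ContinuousLinearMap.adjoint_inner_left]

/-- The two factors `√(n + 1)` cancel the `1 / (n + 1)` lost by symmetrization. This is the
commutation relation without the summand `a*(u) a(w)`. -/
theorem inner_creationLevel_creationLevel (E : Submodule ℂ H) [E.HasOrthogonalProjection] {w : H}
    (hw : w ∈ Eᗮ) (u : H) {n : ℕ} (x y : SymPower H n) :
    ⟪creationLevel w n x, creationLevel u n (projSym E n y)⟫_ℂ
      = ⟪w, u⟫_ℂ * ⟪x, projSym E n y⟫_ℂ := by
  have h := inner_tensorLeft_symProj E hw u (x : TensorPower H n) (y : TensorPower H n)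
  rw [Submodule.starProjection_eq_self_iff.2 (projTensor_mem_symPower E y.2)] at h
  refine Eq.trans ?_ h
  rw [inner_symPower, coe_creationLevel, coe_creationLevel, inner_smul_left, inner_smul_right,
    Complex.conj_ofReal, ← mul_assoc, ← Complex.ofReal_mul, Real.mul_self_sqrt (by positivity),
    Submodule.inner_starProjection_left_eq_right,
    Submodule.starProjection_eq_self_iff.2 (Submodule.starProjection_apply_mem _ _)]
  push_cast
  rfl

theorem norm_creationLevel_projSym (E : Submodule ℂ H) [E.HasOrthogonalProjection] {w : H}
    (hw : w ∈ Eᗮ) {n : ℕ} (x : SymPower H n) :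
    ‖creationLevel w n (projSym E n x)‖ = ‖w‖ * ‖projSym E n x‖ :=
  norm_eq_of_inner_self_eq_mul (inner_creationLevel_creationLevel E hw w (projSym E n x) x)

theorem hasSum_inner_creationSeq (u : H) (x y : Fock H) (hy : Memℓp (creationSeq u y) 2) :
    HasSum (fun n => ⟪x (n + 1), creationLevel u n (y n)⟫_ℂ)
      ⟪x, (⟨creationSeq u y, hy⟩ : Fock H)⟫_ℂ := by
  have h := lp.hasSum_inner (𝕜 := ℂ) x (⟨creationSeq u y, hy⟩ : Fock H)
  -- A created vector has no vacuum component, so dropping the index `0` does not change the sum.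
  rw [← hasSum_nat_add_iff' 1] at h
  simpa [creationSeq] using h

theorem summable_norm_sq (x : Fock H) : Summable fun n => ‖x n‖ ^ 2 := by
  simpa using (lp.memℓp x).summable (by norm_num)

theorem norm_sq_eq_tsum (x : Fock H) : ‖x‖ ^ 2 = ∑' n, ‖x n‖ ^ 2 := by
  simpa using lp.norm_rpow_eq_tsum (p := 2) (by norm_num) x

theorem memℓp_two_iff (x : ∀ n, SymPower H n) : Memℓp x 2 ↔ Summable fun n => ‖x n‖ ^ 2 := by
  simpa using memℓp_gen_iff (p := 2) (f := x) (by norm_num)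

theorem norm_creationSeq_le (E : Submodule ℂ H) [E.HasOrthogonalProjection] {w : H}
    (hw : w ∈ Eᗮ) (x : Fock H) (n : ℕ) :
    ‖creationSeq w (secondQuant E x) (n + 1)‖ ^ 2 ≤ ‖w‖ ^ 2 * ‖x n‖ ^ 2 := by
  rw [← mul_pow]
  refine pow_le_pow_left₀ (norm_nonneg _) ?_ 2
  exact (norm_creationLevel_projSym E hw (x n)).le.trans (by gcongr; exact norm_projSym_le E _)

theorem memℓp_creationSeq (E : Submodule ℂ H) [E.HasOrthogonalProjection] {w : H}
    (hw : w ∈ Eᗮ) (x : Fock H) : Memℓp (creationSeq w (secondQuant E x)) 2 := by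
  rw [memℓp_two_iff, ← summable_nat_add_iff 1]
  exact ((summable_norm_sq x).mul_left (‖w‖ ^ 2)).of_nonneg_of_le (fun n => by positivity)
    (norm_creationSeq_le E hw x)

/-- The bounded operator `a*(w) Γ(E)`, where `Γ(E)` is the second quantization of the projection
onto a subspace `E` orthogonal to `w`. -/
def creationProj (E : Submodule ℂ H) [E.HasOrthogonalProjection] {w : H} (hw : w ∈ Eᗮ) :
    Fock H →L[ℂ] Fock H :=
  LinearMap.mkContinuous
    { toFun := fun x => ⟨creationSeq w (secondQuant E x), memℓp_creationSeq E hw x⟩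
      map_add' := fun x y => Subtype.ext (by simp; rfl)
      map_smul' := fun c x => Subtype.ext (by simp; rfl) } ‖w‖ fun x => by
    refine (pow_le_pow_iff_left₀ (norm_nonneg _) (by positivity) two_ne_zero).1 ?_
    have hs := summable_norm_sq (⟨creationSeq w (secondQuant E x), memℓp_creationSeq E hw x⟩ : Fock H)
    rw [mul_pow, norm_sq_eq_tsum, norm_sq_eq_tsum, ← tsum_mul_left]
    refine (hs.tsum_eq_zero_add).trans_le ?_
    rw [show ‖creationSeq w (secondQuant E x) 0‖ ^ 2 = 0 by simp [creationSeq], zero_add]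
    exact ((summable_nat_add_iff 1).2 hs).tsum_le_tsum (norm_creationSeq_le E hw x)
      ((summable_norm_sq x).mul_left (‖w‖ ^ 2))

theorem creationProj_apply (E : Submodule ℂ H) [E.HasOrthogonalProjection] {w : H} (hw : w ∈ Eᗮ)
    (x : Fock H) : creationProj E hw x
      = ⟨creationSeq w (secondQuant E x), memℓp_creationSeq E hw x⟩ := rfl

/-- The duality of `a(w)` and `a*(w)`, valid for `x` in the maximal domain of `a(w)` and for every
`y`, because `a*(w) Γ(E)` is bounded. -/
theorem inner_creationProj_right (E : Submodule ℂ H) [E.HasOrthogonalProjection] {w : H}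
    (hw : w ∈ Eᗮ) (x y : Fock H) (hx : Memℓp (annihilationSeq w x) 2) :
    ⟪(⟨annihilationSeq w x, hx⟩ : Fock H), secondQuant E y⟫_ℂ = ⟪x, creationProj E hw y⟫_ℂ := by
  rw [creationProj_apply, ← (hasSum_inner_creationSeq w x _ _).tsum_eq, lp.inner_eq_tsum]
  exact tsum_congr fun n => (inner_creationLevel_right w n _ _).symm

/-- As `Γ(E) y` also lies in the Fock space over the larger space `F`, the levelwise identity
applies with `F`, to which `w` is orthogonal. The nested pair serves to compare two different
colors. -/
theorem inner_creationProj_creationProj (E F : Submodule ℂ H) [E.HasOrthogonalProjection]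
    [F.HasOrthogonalProjection] (hEF : E ≤ F) {w u : H} (hw : w ∈ Fᗮ) (hu : u ∈ Eᗮ) (x y : Fock H) :
    ⟪creationProj F hw x, creationProj E hu y⟫_ℂ
      = ⟪w, u⟫_ℂ * ⟪x, secondQuant E y⟫_ℂ := by
  rw [creationProj_apply E hu, ← (hasSum_inner_creationSeq u _ _ _).tsum_eq,
    ← secondQuant_secondQuant hEF, ← inner_secondQuant_left, lp.inner_eq_tsum, ← tsum_mul_left]
  refine tsum_congr fun n => ?_
  have h := inner_creationLevel_creationLevel F hw u (secondQuant F x n) (secondQuant E y n)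
  rw [← secondQuant_apply F, secondQuant_secondQuant hEF] at h
  rw [secondQuant_secondQuant hEF]
  exact h

theorem norm_prodVec {n : ℕ} (v : Fin n → H) : ‖prodVec v‖ = ‖symProd v‖ :=
  lp.norm_single (by norm_num) n _

theorem norm_prodVec_zero (v : Fin 0 → H) : ‖prodVec v‖ = 1 := by
  simp [norm_prodVec, symProd, norm_tprod]

/-- Vectors of a total set yield a total set of symmetric products. -/
theorem topologicalClosure_span_prodVec {s : Set H}
    (hs : (Submodule.span ℂ s).topologicalClosure = ⊤) :
    (Submodule.span ℂ {x | ∃ (n : ℕ) (v : Fin n → H), (∀ j, v j ∈ s) ∧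
      x = prodVec v}).topologicalClosure = ⊤ := by
  set S : Submodule ℂ (Fock H) := (Submodule.span ℂ {x | ∃ (n : ℕ) (v : Fin n → H),
    (∀ j, v j ∈ s) ∧ x = prodVec v}).topologicalClosure with hS
  have hc : IsClosed (S : Set (Fock H)) := Submodule.isClosed_topologicalClosure _
  -- Induction on the set `t` of slots released from the constraint of lying in `s`; a slot is
  -- released by continuity and linearity of the product in that slot.
  have h1 : ∀ (n : ℕ) (t : Finset (Fin n)) (v : Fin n → H), (∀ j ∉ t, v j ∈ s) →
      prodVec v ∈ S := by
    intro n t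
    induction t using Finset.induction_on with
    | empty =>
      intro v hv
      exact Submodule.le_topologicalClosure _ (Submodule.subset_span ⟨n, v, by simpa using hv, rfl⟩)
    | insert a t ha ih =>
      intro v hv
      let φ : H →L[ℂ] Fock H := lp.singleContinuousLinearMap ℂ (fun n => SymPower H n) 2 n ∘L
        (SymPower H n).orthogonalProjectionOnto ∘L (tprodMultilinear n).toContinuousLinearMap v a
      have hφ : ∀ u, φ u = prodVec (Function.update v a u) := by
        intro u
        simp only [φ, prodVec, ContinuousLinearMap.comp_apply, lp.singleContinuousLinearMap_apply]
        congr 1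
        exact Subtype.ext (starProjection_symPower_tprod _)
      have ht : (Submodule.span ℂ s).topologicalClosure ≤ S.comap φ.toLinearMap := by
        refine Submodule.topologicalClosure_minimal _ (Submodule.span_le.2 fun u hu => ?_)
          (hc.preimage φ.continuous)
        change φ u ∈ S
        rw [hφ]
        refine ih _ fun j hj => ?_
        rcases eq_or_ne j a with rfl | hja
        · simpa using hu
        · simpa [hja] using hv j (by simp [hja, hj])
      have h := ht (x := v a) (hs ▸ trivial)
      change φ (v a) ∈ S at h
      rwa [hφ, Function.update_eq_self] at h
  -- With every slot released, `S` contains all symmetric products, hence each closed `n`-particle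
  -- sector.
  have h2 : ∀ (n : ℕ) (y : SymPower H n), lp.single 2 n y ∈ S := by
    intro n y
    let φ : TensorPower H n →L[ℂ] Fock H := lp.singleContinuousLinearMap ℂ (fun n => SymPower H n) 2 n
      ∘L (SymPower H n).orthogonalProjectionOnto
    have hφ : ∀ y : SymPower H n, φ y = lp.single 2 n y := by
      intro y
      simp [φ]
    have ht : SymPower H n ≤ S.comap φ.toLinearMap := by
      refine Submodule.topologicalClosure_minimal _ (Submodule.span_le.2 ?_)
        (hc.preimage φ.continuous)
      rintro _ ⟨v, rfl⟩
      have h := h1 n Finset.univ v (by simp)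
      rw [prodVec, ← hφ] at h
      exact h
    have h := ht y.2
    change φ y ∈ S at h
    rwa [hφ] at h
  refine top_unique fun x _ => ?_
  exact hc.mem_of_tendsto (lp.hasSum_single (by norm_num) x)
    (Filter.Eventually.of_forall fun t => Submodule.sum_mem _ fun n _ => h2 n _)

end Tensors

/-! ### Colored vectors, their totality, and uniqueness of bounded extensions. -/

section Colors

variable {G : Type*} [NormedAddCommGroup G] [InnerProductSpace ℂ G]

theorem inner_elemTensor (f g : KSpace) (a b : G) :
    ⟪elemTensor f a, elemTensor g b⟫_ℂ = ⟪f, g⟫_ℂ * ⟪a, b⟫_ℂ := by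
  rw [L2.inner_def, L2.inner_def, ← integral_mul_const]
  refine integral_congr_ae ?_
  filter_upwards [(ContinuousLinearMap.toSpanSingleton ℂ a).coeFn_compLp f,
    (ContinuousLinearMap.toSpanSingleton ℂ b).coeFn_compLp g] with t hf hg
  rw [elemTensor, elemTensor, hf, hg]
  simp [inner_smul_left, inner_smul_right]
  ring

/-- The vectors `f ⊗ g` depend on `g` through a bounded operator. -/
def elemTensorRight (f : KSpace) : G →L[ℂ] HSpace G :=
  LinearMap.mkContinuous
    { toFun := elemTensor f
      map_add' := fun a b => by
        simp only [elemTensor, ContinuousLinearMap.toSpanSingleton_add,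
          ContinuousLinearMap.add_compLp]
      map_smul' := fun c a => by
        simp only [elemTensor, ContinuousLinearMap.toSpanSingleton_smul,
          ContinuousLinearMap.smul_compLp, RingHom.id_apply] } ‖f‖ fun a => by
    refine (ContinuousLinearMap.norm_compLp_le _ f).trans_eq ?_
    rw [ContinuousLinearMap.norm_toSpanSingleton, mul_comm]

theorem elemTensor_indicatorConstLp {s : Set ℝ} (hs : MeasurableSet s)
    (hμs : volume.restrict (Set.Ici (0 : ℝ)) s ≠ ∞) (c : G) :
    elemTensor (indicatorConstLp 2 hs hμs (1 : ℂ)) c = indicatorConstLp 2 hs hμs c := by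
  refine Lp.ext ?_
  filter_upwards [(ContinuousLinearMap.toSpanSingleton ℂ c).coeFn_compLp
    (indicatorConstLp 2 hs hμs (1 : ℂ)), indicatorConstLp_coeFn (p := 2) (hs := hs) (hμs := hμs)
    (c := (1 : ℂ)), indicatorConstLp_coeFn (p := 2) (hs := hs) (hμs := hμs) (c := c)]
    with t h1 h2 h3
  rw [elemTensor, h1, h2, h3]
  by_cases ht : t ∈ s <;> simp [ht]

variable (e : HilbertBasis ℕ+ ℂ G)

theorem inner_elemTensor_basis (f g : KSpace) (j k : ℕ+) :
    ⟪elemTensor f (e j), elemTensor g (e k)⟫_ℂ = if j = k then ⟪f, g⟫_ℂ else 0 := by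
  rw [inner_elemTensor, orthonormal_iff_ite.1 e.orthonormal]
  simp

theorem elemTensor_mem_filterSpace (f : KSpace) {k : ℕ+} {σ : Set ℕ+} (hk : k ∈ σ) :
    elemTensor f (e k) ∈ filterSpace e σ :=
  Submodule.le_topologicalClosure _ (Submodule.subset_span ⟨f, k, hk, rfl⟩)

theorem filterSpace_mono {σ τ : Set ℕ+} (h : σ ⊆ τ) : filterSpace e σ ≤ filterSpace e τ :=
  Submodule.topologicalClosure_mono (Submodule.span_mono fun _ ⟨f, k, hk, hu⟩ => ⟨f, k, h hk, hu⟩)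

theorem elemTensor_mem_closure (f : KSpace) (c : G) : elemTensor f c ∈
    (Submodule.span ℂ {u | ∃ (f : KSpace) (k : ℕ+), u = elemTensor f (e k)}).topologicalClosure := by
  set S := (Submodule.span ℂ
    {u | ∃ (f : KSpace) (k : ℕ+), u = elemTensor f (e k)}).topologicalClosure
  have h : (Submodule.span ℂ (Set.range e)).topologicalClosure
      ≤ S.comap (elemTensorRight f).toLinearMap := by
    refine Submodule.topologicalClosure_minimal _ (Submodule.span_le.2 ?_)
      ((Submodule.isClosed_topologicalClosure _).preimage (elemTensorRight f).continuous)
    rintro _ ⟨k, rfl⟩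
    exact Submodule.le_topologicalClosure _ (Submodule.subset_span ⟨f, k, rfl⟩)
  rw [e.dense_span] at h
  exact h (x := c) trivial

theorem coloredParticle_le_finiteParticle : coloredParticle e ≤ finiteParticle (HSpace G) :=
  Submodule.span_mono fun _ ⟨n, _, _, hx⟩ => ⟨n, _, hx⟩

theorem elemTensor_mem_filterSpace_orthogonal (f : KSpace) {k : ℕ+} {σ : Set ℕ+} (hk : k ∉ σ) :
    elemTensor f (e k) ∈ (filterSpace e σ)ᗮ := by
  rw [filterSpace, Submodule.orthogonal_closure, Submodule.mem_orthogonal]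
  intro u hu
  induction hu using Submodule.span_induction with
  | mem u h =>
    obtain ⟨g, j, hj, rfl⟩ := h
    rw [inner_elemTensor_basis, if_neg (by rintro rfl; exact hk hj)]
  | zero => simp
  | add y z _ _ hy hz => simp [inner_add_left, hy, hz]
  | smul c y _ hy => simp [inner_smul_left, hy]

/-- Step functions are dense in `L²(ℝ₊, G)`; a single step with value `c` on `s` is the elementary
tensor of the indicator of `s` and `c`, and `c` is approximated by combinations of basis vectors. -/
theorem topologicalClosure_span_elemTensor :
    (Submodule.span ℂ
      {u | ∃ (f : KSpace) (k : ℕ+), u = elemTensor f (e k)}).topologicalClosure = ⊤ := by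
  refine top_unique fun u _ => ?_
  refine Lp.induction (by norm_num) (fun u => u ∈ (Submodule.span ℂ
    {u | ∃ (f : KSpace) (k : ℕ+), u = elemTensor f (e k)}).topologicalClosure) ?_ ?_ ?_ u
  · intro c s hs hμs
    rw [Lp.simpleFunc.coe_indicatorConst, ← elemTensor_indicatorConstLp]
    exact elemTensor_mem_closure e _ c
  · intro f g hf hg _ h1 h2
    exact Submodule.add_mem _ h1 h2
  · exact Submodule.isClosed_topologicalClosure _

theorem topologicalClosure_coloredParticle : (coloredParticle e).topologicalClosure = ⊤ := by
  rw [← topologicalClosure_span_prodVec (topologicalClosure_span_elemTensor e), coloredParticle]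
  congr 2
  ext x
  constructor
  · rintro ⟨n, f, k, rfl⟩
    exact ⟨n, _, fun j => ⟨f j, k j, rfl⟩, rfl⟩
  · rintro ⟨n, v, hv, rfl⟩
    choose f k hfk using hv
    exact ⟨n, f, k, by rw [funext hfk]⟩

/-- Reduces the claim on a series of partially defined operators to bounded operators `D i` that
extend the terms and sum strongly to `L`. -/
theorem isUniqueBoundedExtension_strongSum {ι : Type*}
    {T : ι → (Fock (HSpace G) →ₗ.[ℂ] Fock (HSpace G))}
    {D : ι → (Fock (HSpace G) →L[ℂ] Fock (HSpace G))} {L : Fock (HSpace G) →L[ℂ] Fock (HSpace G)}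
    (hT : ∀ i, finiteParticle (HSpace G) ≤ (T i).domain) (hD : ∀ i (x : (T i).domain), T i x = D i x)
    (hL : ∀ x, HasSum (fun i => D i x) (L x)) :
    IsUniqueBoundedExtension e (strongSum T) L := by
  have hle : finiteParticle (HSpace G) ≤ (strongSum T).domain := fun x hx =>
    ⟨fun i => hT i hx, (hL x).summable.congr fun i => (hD i ⟨x, hT i hx⟩).symm⟩
  have hex : ∀ x : (strongSum T).domain, L x = strongSum T x := fun x =>
    (hL x).tsum_eq.symm.trans (tsum_congr fun i => (hD i ⟨x, x.2.1 i⟩).symm)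
  refine ⟨hle, hex, fun L' h => ?_⟩
  refine ContinuousLinearMap.ext_on (s := coloredParticle e) ?_ fun x hx => ?_
  · rw [Submodule.span_eq]
    exact Submodule.dense_iff_topologicalClosure_eq_top.2 (topologicalClosure_coloredParticle e)
  · have hx' := hle (coloredParticle_le_finiteParticle e hx)
    exact (h ⟨x, hx'⟩ hx).trans (hex ⟨x, hx'⟩).symm

/-! ### The projections of the color filtration -/

variable [CompleteSpace G]

theorem levelProj_zero : levelProj e 0 = 0 := if_pos rfl

theorem levelProj_pos {r : ℕ} (hr : r ≠ 0) :
    levelProj e r = secondQuant (filterSpace e {k | (k : ℕ) < r}) := if_neg hr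

theorem inner_levelProj_left (r : ℕ) (x y : Fock (HSpace G)) :
    ⟪levelProj e r x, y⟫_ℂ = ⟪x, levelProj e r y⟫_ℂ := by
  rcases eq_or_ne r 0 with rfl | hr
  · simp [levelProj_zero]
  · rw [levelProj_pos e hr, inner_secondQuant_left]

theorem levelProj_levelProj {r s : ℕ} (h : r ≤ s) (x : Fock (HSpace G)) :
    levelProj e s (levelProj e r x) = levelProj e r x := by
  rcases eq_or_ne r 0 with rfl | hr
  · simp [levelProj_zero]
  · rw [levelProj_pos e hr, levelProj_pos e (by omega)]
    have hσ : {k : ℕ+ | (k : ℕ) < r} ⊆ {k : ℕ+ | (k : ℕ) < s} := fun k hk => lt_of_lt_of_le hk h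
    exact secondQuant_secondQuant (filterSpace_mono e hσ) x

/-- The adjoint form of `levelProj_levelProj`. -/
theorem levelProj_levelProj_of_ge {r s : ℕ} (h : r ≤ s) (x : Fock (HSpace G)) :
    levelProj e r (levelProj e s x) = levelProj e r x := by
  refine ext_inner_right ℂ fun y => ?_
  rw [inner_levelProj_left, inner_levelProj_left, levelProj_levelProj e h, ← inner_levelProj_left]

/-- The projection `P^(k) - P^(k-1)` onto the vectors whose highest color is `k - 1`. -/
def colorProj (k : ℕ+) : Fock (HSpace G) →L[ℂ] Fock (HSpace G) :=
  levelProj e k - levelProj e ((k : ℕ) - 1)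

theorem colorProj_apply (k : ℕ+) (x : Fock (HSpace G)) :
    colorProj e k x = levelProj e k x - levelProj e ((k : ℕ) - 1) x := rfl

theorem inner_colorProj_left (k : ℕ+) (x y : Fock (HSpace G)) :
    ⟪colorProj e k x, y⟫_ℂ = ⟪x, colorProj e k y⟫_ℂ := by
  simp only [colorProj_apply, inner_sub_left, inner_sub_right, inner_levelProj_left]

theorem levelProj_colorProj_of_le {k : ℕ+} {r : ℕ} (h : (k : ℕ) ≤ r) (x : Fock (HSpace G)) :
    levelProj e r (colorProj e k x) = colorProj e k x := by
  rw [colorProj_apply, map_sub, levelProj_levelProj e h, levelProj_levelProj e (by omega)]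

theorem levelProj_colorProj_of_lt {k : ℕ+} {r : ℕ} (h : r < (k : ℕ)) (x : Fock (HSpace G)) :
    levelProj e r (colorProj e k x) = 0 := by
  rw [colorProj_apply, map_sub, levelProj_levelProj_of_ge e h.le,
    levelProj_levelProj_of_ge e (by omega), sub_self]

theorem colorProj_colorProj (j k : ℕ+) (x : Fock (HSpace G)) :
    colorProj e j (colorProj e k x) = if j = k then colorProj e k x else 0 := by
  rw [colorProj_apply e j]
  rcases lt_trichotomy j k with h | rfl | h
  · have h' : (j : ℕ) < k := h
    rw [levelProj_colorProj_of_lt e h', levelProj_colorProj_of_lt e (by omega), if_neg h.ne, sub_zero]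
  · rw [levelProj_colorProj_of_le e le_rfl,
      levelProj_colorProj_of_lt e (Nat.sub_lt j.pos one_pos), if_pos rfl, sub_zero]
  · have h' : (k : ℕ) < j := h
    rw [levelProj_colorProj_of_le e h'.le, levelProj_colorProj_of_le e (by omega), if_neg h.ne',
      sub_self]

/-- A finite sum of mutually orthogonal projections is a projection. -/
theorem norm_sum_colorProj_le (s : Finset ℕ+) (x : Fock (HSpace G)) :
    ‖∑ k ∈ s, colorProj e k x‖ ≤ ‖x‖ := by
  have h : ⟪∑ k ∈ s, colorProj e k x, ∑ k ∈ s, colorProj e k x⟫_ℂ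
      = ⟪x, ∑ k ∈ s, colorProj e k x⟫_ℂ := by
    rw [sum_inner, inner_sum]
    refine Finset.sum_congr rfl fun j hj => ?_
    rw [inner_colorProj_left, map_sum]
    simp [colorProj_colorProj, hj]
  have h2 : ‖∑ k ∈ s, colorProj e k x‖ * ‖∑ k ∈ s, colorProj e k x‖
      ≤ ‖x‖ * ‖∑ k ∈ s, colorProj e k x‖ := by
    refine le_trans (le_of_eq ?_) (norm_inner_le_norm (𝕜 := ℂ) x _)
    rw [← h, inner_self_eq_norm_sq_to_K]
    simp [sq]
  rcases (norm_nonneg (∑ k ∈ s, colorProj e k x)).eq_or_lt with h0 | h0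
  · rw [← h0]; exact norm_nonneg _
  · exact le_of_mul_le_mul_right h2 h0

theorem sum_range_colorProj (n : ℕ) (x : Fock (HSpace G)) :
    ∑ i ∈ Finset.range n, colorProj e i.succPNat x = levelProj e n x := by
  -- Telescoping: `i.succPNat` is `i + 1`, and the lower end `P^(0)` is zero.
  have h := Finset.sum_range_sub (fun i => levelProj e i x) n
  rw [levelProj_zero, zero_apply, sub_zero] at h
  exact h

theorem levelProj_prodVec {n r : ℕ} (f : Fin n → KSpace) (k : Fin n → ℕ+)
    (h : ∀ j, (k j : ℕ) < r) (hr : r ≠ 0) :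
    levelProj e r (prodVec fun j => elemTensor (f j) (e (k j)))
      = prodVec fun j => elemTensor (f j) (e (k j)) := by
  rw [levelProj_pos e hr, secondQuant_prodVec]
  congr 1
  ext1 j
  exact Submodule.starProjection_eq_self_iff.2 (elemTensor_mem_filterSpace e _ (h j))

theorem exists_levelProj_eq {x : Fock (HSpace G)} (hx : x ∈ coloredParticle e) :
    ∃ r : ℕ, levelProj e r x = x := by
  induction hx using Submodule.span_induction with
  | mem x h =>
    obtain ⟨n, f, k, rfl⟩ := h
    -- A crude level above all colors that occur; it is positive even for the vacuum.
    refine ⟨(∑ j, (k j : ℕ)) + 1, levelProj_prodVec e f k (fun j => Nat.lt_succ_of_le ?_)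
      (Nat.succ_ne_zero _)⟩
    exact Finset.single_le_sum (f := fun j => (k j : ℕ)) (fun _ _ => Nat.zero_le _)
      (Finset.mem_univ j)
  | zero => exact ⟨0, map_zero _⟩
  | add x y _ _ hx hy =>
    obtain ⟨r, hr⟩ := hx
    obtain ⟨s, hs⟩ := hy
    refine ⟨max r s, ?_⟩
    rw [map_add, ← hr, ← hs, levelProj_levelProj e (le_max_left _ _),
      levelProj_levelProj e (le_max_right _ _)]
  | smul c x _ hx =>
    obtain ⟨r, hr⟩ := hx
    exact ⟨r, by rw [map_smul, hr]⟩

/-- The partial sums are uniformly bounded by `1`, and on the dense span of colored products they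
are eventually the identity. -/
theorem hasSum_colorProj (x : Fock (HSpace G)) : HasSum (fun k => colorProj e k x) x := by
  rw [HasSum, SummationFilter.unconditional_filter, Metric.tendsto_atTop]
  intro ε hε
  have hx : x ∈ (coloredParticle e).topologicalClosure := by
    rw [topologicalClosure_coloredParticle]; trivial
  obtain ⟨y, hy, hxy⟩ := Metric.mem_closure_iff.1 hx (ε / 2) (by positivity)
  obtain ⟨r, hr⟩ := exists_levelProj_eq e hy
  -- The indices `1, …, r` suffice to recover `y`: for `k > r` both `P^(k)` and `P^(k-1)` fix `y`.
  refine ⟨(Finset.range r).image Nat.succPNat, fun s hs => ?_⟩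
  have h1 : ∑ k ∈ s, colorProj e k y = y := by
    rw [← Finset.sum_subset hs, Finset.sum_image fun _ _ _ _ h => Nat.succPNat_injective h,
      sum_range_colorProj, hr]
    intro k _ hk
    have hk' : r < (k : ℕ) := by
      by_contra hlt
      refine hk (Finset.mem_image.2 ⟨k.natPred, ?_, PNat.succPNat_natPred k⟩)
      have := PNat.natPred_add_one k
      simp only [Finset.mem_range]
      omega
    rw [← hr, colorProj_apply, levelProj_levelProj e hk'.le, levelProj_levelProj e (by omega),
      sub_self]
  have h2 : ∑ k ∈ s, colorProj e k x - x = ∑ k ∈ s, colorProj e k (x - y) - (x - y) := by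
    simp only [map_sub, Finset.sum_sub_distrib, h1]
    abel
  rw [dist_eq_norm, h2]
  rw [dist_eq_norm] at hxy
  linarith [norm_sub_le (∑ k ∈ s, colorProj e k (x - y)) (x - y),
    norm_sum_colorProj_le e s (x - y)]

theorem inner_orderProj_left (m : ℕ∞) (x y : Fock (HSpace G)) :
    ⟪orderProj e m x, y⟫_ℂ = ⟪x, orderProj e m y⟫_ℂ := by
  cases m with
  | top => rfl
  | coe r => exact inner_levelProj_left e r x y

theorem orderProj_colorProj (m : ℕ∞) (k : ℕ+) (x : Fock (HSpace G)) :
    orderProj e m (colorProj e k x) = if ((k : ℕ) : ℕ∞) ≤ m then colorProj e k x else 0 := by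
  cases m with
  | top => rw [if_pos le_top]; rfl
  | coe r =>
    change levelProj e r _ = _
    split_ifs with h
    · exact levelProj_colorProj_of_le e (by exact_mod_cast h) x
    · exact levelProj_colorProj_of_lt e (by exact_mod_cast not_le.1 h) x

theorem hasSum_colorProj_orderProj (m : ℕ∞) (x : Fock (HSpace G)) :
    HasSum (fun k : {k : ℕ+ // ((k : ℕ) : ℕ∞) ≤ m} => colorProj e k x) (orderProj e m x) := by
  refine (hasSum_subtype_iff_indicator (s := {k : ℕ+ | ((k : ℕ) : ℕ∞) ≤ m})
    (f := fun k => colorProj e k x)).2 ?_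
  convert (orderProj e m).hasSum (hasSum_colorProj e x) using 2 with k
  simp [Set.indicator_apply, orderProj_colorProj]

end Colors

/-! ### The series of creation operators, its bounded sum, and the adjoint series. -/

section Extended

variable {G : Type*} [NormedAddCommGroup G] [InnerProductSpace ℂ G] [CompleteSpace G]
  (e : HilbertBasis ℕ+ ℂ G)

theorem norm_orderProj_le (m : ℕ∞) (x : Fock (HSpace G)) : ‖orderProj e m x‖ ≤ ‖x‖ := by
  cases m with
  | top => exact le_rfl
  | coe r =>
    change ‖levelProj e r x‖ ≤ _
    rw [← sum_range_colorProj, ← Finset.sum_image (g := Nat.succPNat) (f := fun k => colorProj e k x)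
      fun _ _ _ _ h => Nat.succPNat_injective h]
    exact norm_sum_colorProj_le e _ x

theorem inner_colorProj_self (k : ℕ+) (x : Fock (HSpace G)) :
    ⟪colorProj e k x, colorProj e k x⟫_ℂ = ⟪x, colorProj e k x⟫_ℂ := by
  rw [inner_colorProj_left, colorProj_colorProj, if_pos rfl]

theorem summable_norm_sq_colorProj (x : Fock (HSpace G)) :
    Summable fun k => ‖colorProj e k x‖ ^ 2 := by
  have h := hasSum_inner_right (hasSum_colorProj e x) x
  simp only [← inner_colorProj_self, inner_self_eq_norm_sq_to_K, ← RCLike.ofReal_pow] at h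
  exact Complex.summable_ofReal.1 h.summable

theorem secondQuant_colorProj (k : ℕ+) (x : Fock (HSpace G)) :
    secondQuant (filterSpace e {j | (j : ℕ) < k}) (colorProj e k x) = colorProj e k x := by
  rw [← levelProj_pos e k.ne_zero, levelProj_colorProj_of_le e le_rfl]

/-- The operator `a^(k)*(f ⊗ e_k) - a^(k-1)*(f ⊗ e_k)`, as a bounded operator. -/
def creationTerm (f : KSpace) (k : ℕ+) : Fock (HSpace G) →L[ℂ] Fock (HSpace G) :=
  creationProj (filterSpace e {j | (j : ℕ) < k})
    (elemTensor_mem_filterSpace_orthogonal e f (σ := {j | (j : ℕ) < k}) (lt_irrefl (k : ℕ)))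
    ∘L colorProj e k

theorem creationTerm_apply (f : KSpace) (k : ℕ+) (x : Fock (HSpace G)) :
    creationTerm e f k x = creationProj (filterSpace e {j | (j : ℕ) < k})
      (elemTensor_mem_filterSpace_orthogonal e f (σ := {j | (j : ℕ) < k}) (lt_irrefl (k : ℕ)))
      (colorProj e k x) := rfl

/-- For `k ≤ j` the color spaces are nested and `inner_creationProj_creationProj` produces the
factor `⟪g ⊗ e_j, f ⊗ e_k⟫`, which is zero unless `j = k`. The case `j < k` follows by conjugation.
-/
theorem inner_creationTerm (f g : KSpace) (j k : ℕ+) (x y : Fock (HSpace G)) :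
    ⟪creationTerm e g j x, creationTerm e f k y⟫_ℂ
      = if j = k then ⟪g, f⟫_ℂ * ⟪x, colorProj e k y⟫_ℂ else 0 := by
  have key : ∀ (f g : KSpace) (j k : ℕ+) (x y : Fock (HSpace G)), k ≤ j →
      ⟪creationTerm e g j x, creationTerm e f k y⟫_ℂ
        = if j = k then ⟪g, f⟫_ℂ * ⟪x, colorProj e k y⟫_ℂ else 0 := by
    intro f g j k x y hkj
    have hσ : {i : ℕ+ | (i : ℕ) < k} ⊆ {i : ℕ+ | (i : ℕ) < j} :=
      fun i hi => lt_of_lt_of_le hi (PNat.coe_le_coe _ _ |>.2 hkj)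
    rw [creationTerm_apply, creationTerm_apply,
      inner_creationProj_creationProj _ _ (filterSpace_mono e hσ),
      secondQuant_colorProj, inner_elemTensor_basis, inner_colorProj_left, colorProj_colorProj]
    split_ifs <;> simp
  rcases le_or_gt k j with h | h
  · exact key f g j k x y h
  · rw [← inner_conj_symm, key g f k j y x h.le, if_neg h.ne', if_neg h.ne, map_zero]

theorem norm_creationTerm (f : KSpace) (k : ℕ+) (x : Fock (HSpace G)) :
    ‖creationTerm e f k x‖ = ‖f‖ * ‖colorProj e k x‖ := by
  refine norm_eq_of_inner_self_eq_mul ?_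
  rw [inner_creationTerm, if_pos rfl, inner_colorProj_self]

theorem summable_creationTerm (f : KSpace) (x : Fock (HSpace G)) :
    Summable fun k => creationTerm e f k x := by
  refine summable_of_orthogonal (fun j k hjk => ?_) ?_
  · rw [inner_creationTerm, if_neg hjk]
  · simp only [norm_creationTerm, mul_pow]
    exact (summable_norm_sq_colorProj e x).mul_left (‖f‖ ^ 2)

theorem summable_creationTerm_subtype (m : ℕ∞) (f : KSpace) (x : Fock (HSpace G)) :
    Summable fun k : {k : ℕ+ // ((k : ℕ) : ℕ∞) ≤ m} => creationTerm e f k x :=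
  (summable_creationTerm e f x).subtype {k : ℕ+ | ((k : ℕ) : ℕ∞) ≤ m}

/-- Off-diagonal terms vanish, and the diagonal ones add up to `⟪g, f⟫ ⟪x, P^(m) y⟫` because the
`D_k` with `k ≤ m` sum to `P^(m)`. -/
theorem inner_tsum_creationTerm (m : ℕ∞) (f g : KSpace) (x y : Fock (HSpace G)) :
    ⟪∑' k : {k : ℕ+ // ((k : ℕ) : ℕ∞) ≤ m}, creationTerm e g k x,
      ∑' k : {k : ℕ+ // ((k : ℕ) : ℕ∞) ≤ m}, creationTerm e f k y⟫_ℂ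
      = ⟪g, f⟫_ℂ * ⟪x, orderProj e m y⟫_ℂ := by
  have h1 : ∀ j : {k : ℕ+ // ((k : ℕ) : ℕ∞) ≤ m}, ⟪creationTerm e g j x,
      ∑' k : {k : ℕ+ // ((k : ℕ) : ℕ∞) ≤ m}, creationTerm e f k y⟫_ℂ
        = ⟪g, f⟫_ℂ * ⟪x, colorProj e j y⟫_ℂ := by
    intro j
    rw [← (hasSum_inner_right (summable_creationTerm_subtype e m f y).hasSum _).tsum_eq,
      tsum_eq_single j fun k hk => ?_]
    · rw [inner_creationTerm, if_pos rfl]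
    · rw [inner_creationTerm, if_neg fun h => hk (Subtype.ext h.symm)]
  have h2 := hasSum_inner_left (summable_creationTerm_subtype e m g x).hasSum
    (∑' k : {k : ℕ+ // ((k : ℕ) : ℕ∞) ≤ m}, creationTerm e f k y)
  simp only [h1] at h2
  exact h2.unique ((hasSum_inner_right (hasSum_colorProj_orderProj e m y) x).mul_left _)

/-- The bounded extension of the extended creation operator `l^(m)*(f)`. -/
def boundedCreation (m : ℕ∞) (f : KSpace) : Fock (HSpace G) →L[ℂ] Fock (HSpace G) :=
  LinearMap.mkContinuous
    { toFun := fun x => ∑' k : {k : ℕ+ // ((k : ℕ) : ℕ∞) ≤ m}, creationTerm e f k x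
      map_add' := fun x y => by
        simp only [map_add]
        exact (summable_creationTerm_subtype e m f x).tsum_add
          (summable_creationTerm_subtype e m f y)
      map_smul' := fun c x => by
        simp only [map_smul]
        exact (summable_creationTerm_subtype e m f x).tsum_const_smul c } ‖f‖ fun x => by
    exact norm_le_of_inner_self_eq_mul (norm_orderProj_le e m x)
      (inner_tsum_creationTerm e m f f x x)

theorem hasSum_creationTerm (m : ℕ∞) (f : KSpace) (x : Fock (HSpace G)) :
    HasSum (fun k : {k : ℕ+ // ((k : ℕ) : ℕ∞) ≤ m} => creationTerm e f k x)
      (boundedCreation e m f x) :=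
  (summable_creationTerm_subtype e m f x).hasSum

theorem inner_boundedCreation (m : ℕ∞) (f g : KSpace) (x y : Fock (HSpace G)) :
    ⟪boundedCreation e m g x, boundedCreation e m f y⟫_ℂ = ⟪g, f⟫_ℂ * ⟪x, orderProj e m y⟫_ℂ :=
  inner_tsum_creationTerm e m f g x y

theorem norm_boundedCreation {m : ℕ∞} (hm : 1 ≤ m) (f : KSpace) : ‖boundedCreation e m f‖ = ‖f‖ := by
  refine le_antisymm (LinearMap.mkContinuous_norm_le _ (norm_nonneg _) _) ?_
  -- The vacuum, where the norm is attained; the entries are dummies over an empty index set. It is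
  -- fixed by `P^(m)` because `m ≥ 1`.
  let v : Fock (HSpace G) := prodVec (n := 0) fun j => elemTensor (0 : KSpace) (e 1)
  have hP : orderProj e m v = v := by
    cases m with
    | top => rfl
    | coe r =>
      have hr : r ≠ 0 := by
        rintro rfl
        exact absurd hm (by simp)
      exact levelProj_prodVec e (fun _ => 0) (fun _ => 1) (fun j => j.elim0) hr
  have hv : ‖v‖ = 1 := norm_prodVec_zero _
  have h : ‖boundedCreation e m f v‖ = ‖f‖ * ‖v‖ := by
    refine norm_eq_of_inner_self_eq_mul ?_
    rw [inner_boundedCreation, hP]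
  rw [hv, mul_one] at h
  rw [← h]
  simpa only [hv, mul_one] using (boundedCreation e m f).le_opNorm v

theorem creationTerm_colorProj (f : KSpace) (j k : ℕ+) (x : Fock (HSpace G)) :
    creationTerm e f j (colorProj e k x) = if j = k then creationTerm e f k x else 0 := by
  rw [creationTerm, ContinuousLinearMap.comp_apply, colorProj_colorProj]
  split_ifs with h
  · subst h; rfl
  · exact map_zero _

theorem boundedCreation_colorProj {m : ℕ∞} (f : KSpace) (k : {k : ℕ+ // ((k : ℕ) : ℕ∞) ≤ m})
    (x : Fock (HSpace G)) : boundedCreation e m f (colorProj e k x) = creationTerm e f k x := by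
  refine (hasSum_creationTerm e m f _).tsum_eq.symm.trans ?_
  rw [tsum_eq_single k fun j hj => ?_]
  · rw [creationTerm_colorProj, if_pos rfl]
  · rw [creationTerm_colorProj, if_neg fun h => hj (Subtype.ext h)]

theorem boundedCreation_orderProj (m : ℕ∞) (f : KSpace) (x : Fock (HSpace G)) :
    boundedCreation e m f (orderProj e m x) = boundedCreation e m f x := by
  refine ((boundedCreation e m f).hasSum (hasSum_colorProj_orderProj e m x)).unique ?_
  convert hasSum_creationTerm e m f x using 2 with k
  exact boundedCreation_colorProj e f k x

theorem colorProj_adjoint_boundedCreation {m : ℕ∞} (f : KSpace)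
    (k : {k : ℕ+ // ((k : ℕ) : ℕ∞) ≤ m}) (x : Fock (HSpace G)) :
    colorProj e k ((boundedCreation e m f).adjoint x) = (creationTerm e f k).adjoint x := by
  refine ext_inner_right ℂ fun y => ?_
  rw [inner_colorProj_left, ContinuousLinearMap.adjoint_inner_left,
    ContinuousLinearMap.adjoint_inner_left, boundedCreation_colorProj]

/-- Taking adjoints does not preserve strong convergence in general. Here `P^(m)` fixes the range of
the adjoint, so the adjoint applied to `x` is the sum of its parts under the `D_k`, and these parts
are the adjoint terms. -/
theorem hasSum_adjoint_creationTerm (m : ℕ∞) (f : KSpace) (x : Fock (HSpace G)) :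
    HasSum (fun k : {k : ℕ+ // ((k : ℕ) : ℕ∞) ≤ m} => (creationTerm e f k).adjoint x)
      ((boundedCreation e m f).adjoint x) := by
  have h := hasSum_colorProj_orderProj e m ((boundedCreation e m f).adjoint x)
  have h2 : orderProj e m ((boundedCreation e m f).adjoint x)
      = (boundedCreation e m f).adjoint x := by
    refine ext_inner_right ℂ fun y => ?_
    rw [inner_orderProj_left, ContinuousLinearMap.adjoint_inner_left,
      ContinuousLinearMap.adjoint_inner_left, boundedCreation_orderProj]
  rw [h2] at h
  simpa only [colorProj_adjoint_boundedCreation] using h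

theorem adjoint_boundedCreation_comp (m : ℕ∞) (f g : KSpace) :
    (boundedCreation e m g).adjoint ∘L boundedCreation e m f = ⟪g, f⟫_ℂ • orderProj e m := by
  ext1 y
  refine ext_inner_left ℂ fun x => ?_
  rw [ContinuousLinearMap.comp_apply, ContinuousLinearMap.adjoint_inner_right,
    inner_boundedCreation, smul_apply, inner_smul_right]

/-! ### The series on their domains -/

/-- Since the filter `{j | j < r}` omits `k`, the filtered creation operators of levels `k` and `k -
1` are defined everywhere. -/
theorem memℓp_creationSeq_levelProj (f : KSpace) {k : ℕ+} {r : ℕ} (h : r ≤ k)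
    (x : Fock (HSpace G)) : Memℓp (creationSeq (elemTensor f (e k)) (levelProj e r x)) 2 := by
  rcases eq_or_ne r 0 with rfl | hr
  · rw [levelProj_zero, zero_apply, map_zero]
    exact zero_memℓp
  · rw [levelProj_pos e hr]
    exact memℓp_creationSeq _ (elemTensor_mem_filterSpace_orthogonal e f
      (σ := {j | (j : ℕ) < r}) (not_lt.2 h)) x

theorem isUniqueBoundedExtension_extCreation (m : ℕ∞) (f : KSpace) :
    IsUniqueBoundedExtension e (extCreation e m f) (boundedCreation e m f) := by
  refine isUniqueBoundedExtension_strongSum e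
    (T := fun k : {k : ℕ+ // ((k : ℕ) : ℕ∞) ≤ m} =>
      filteredCreation e (k.1 : ℕ) f k - filteredCreation e ((k.1 : ℕ) - 1) f k)
    (D := fun k => creationTerm e f k)
    (fun k x _ => Submodule.mem_inf.2 ⟨memℓp_creationSeq_levelProj e f le_rfl x,
      memℓp_creationSeq_levelProj e f (Nat.sub_le _ _) x⟩)
    (fun k x => ?_) (hasSum_creationTerm e m f)
  rw [LinearPMap.sub_apply]
  refine Subtype.ext ?_
  refine Eq.trans ?_ (congrArg (creationSeq (elemTensor f (e k)))
    (secondQuant_colorProj e k (x : Fock (HSpace G))).symm)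
  rw [colorProj_apply, map_sub]
  rfl

theorem annihilationSeq_prodVec {H : Type*} [NormedAddCommGroup H] [InnerProductSpace ℂ H]
    (u : H) {n : ℕ} (v : Fin n → H) : Memℓp (annihilationSeq u (prodVec v)) 2 := by
  rw [memℓp_two_iff]
  refine summable_of_ne_finset_zero (s := Finset.range n) fun k hk => ?_
  have h : prodVec v (k + 1) = 0 := by
    rw [prodVec]
    exact lp.single_apply_ne _ _ _ (by simp at hk; omega)
  change ‖annihilationLevel u k (prodVec v (k + 1))‖ ^ 2 = 0
  rw [h]
  simp

theorem finiteParticle_le_annihilation {H : Type*} [NormedAddCommGroup H] [InnerProductSpace ℂ H]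
    (u : H) : finiteParticle H ≤ (annihilation u).domain := by
  refine Submodule.span_le.2 ?_
  rintro _ ⟨n, v, rfl⟩
  exact annihilationSeq_prodVec u v

theorem isUniqueBoundedExtension_extAnnihilation (m : ℕ∞) (f : KSpace) :
    IsUniqueBoundedExtension e (extAnnihilation e m f) (boundedCreation e m f).adjoint := by
  refine isUniqueBoundedExtension_strongSum e
    (T := fun k : {k : ℕ+ // ((k : ℕ) : ℕ∞) ≤ m} =>
      filteredAnnihilation e (k.1 : ℕ) f k - filteredAnnihilation e ((k.1 : ℕ) - 1) f k)
    (D := fun k => (creationTerm e f k).adjoint)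
    (fun k x hx => Submodule.mem_inf.2 ⟨finiteParticle_le_annihilation _ hx,
      finiteParticle_le_annihilation _ hx⟩)
    (fun k x => ?_) (hasSum_adjoint_creationTerm e m f)
  rw [LinearPMap.sub_apply]
  have hx : Memℓp (annihilationSeq (elemTensor f (e k)) x) 2 := x.2.1
  -- On the domain of `a(f ⊗ e_k)` the term is `D_k a(f ⊗ e_k)`; it is compared with the adjoint of
  -- `a*(f ⊗ e_k) D_k` by pairing with `y`.
  change colorProj e k (⟨annihilationSeq (elemTensor f (e k)) x, hx⟩ : Fock (HSpace G)) = _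
  refine ext_inner_right ℂ fun y => ?_
  rw [inner_colorProj_left, ContinuousLinearMap.adjoint_inner_left, ← secondQuant_colorProj]
  exact inner_creationProj_right _ (elemTensor_mem_filterSpace_orthogonal e f
    (σ := {j | (j : ℕ) < k.1}) (lt_irrefl (k.1 : ℕ))) _ _ hx

end Extended

end FilteredFock

end

theorem theorem9p3 {G : Type*} [NormedAddCommGroup G] [InnerProductSpace ℂ G] [CompleteSpace G]
    (e : HilbertBasis ℕ+ ℂ G) (m : ℕ∞) (hm : 1 ≤ m) :
    ∃ Lc La : FilteredFock.KSpace →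
        (FilteredFock.Fock (FilteredFock.HSpace G) →L[ℂ]
          FilteredFock.Fock (FilteredFock.HSpace G)),
      (∀ f, FilteredFock.IsUniqueBoundedExtension e (FilteredFock.extCreation e m f) (Lc f)) ∧
      (∀ f, FilteredFock.IsUniqueBoundedExtension e (FilteredFock.extAnnihilation e m f) (La f)) ∧
      (∀ f, ‖Lc f‖ = ‖f‖) ∧ (∀ f, ‖La f‖ = ‖f‖) ∧
      (∀ f, (Lc f).adjoint = La f ∧ (La f).adjoint = Lc f) ∧
      (∀ f g, La g ∘L Lc f = ⟪g, f⟫_ℂ • FilteredFock.orderProj e m) :=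
  ⟨FilteredFock.boundedCreation e m, fun f => (FilteredFock.boundedCreation e m f).adjoint,
    FilteredFock.isUniqueBoundedExtension_extCreation e m,
    FilteredFock.isUniqueBoundedExtension_extAnnihilation e m,
    FilteredFock.norm_boundedCreation e hm,
    fun f => (ContinuousLinearMap.adjoint.norm_map _).trans
      (FilteredFock.norm_boundedCreation e hm f),
    fun _ => ⟨rfl, ContinuousLinearMap.adjoint_adjoint _⟩,
    fun f g => FilteredFock.adjoint_boundedCreation_comp e m f g⟩
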